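/- Let $H\in(1/2,1)$, $a,b\in\mathbb R$, $ab\neq0$. Put $c(H)=\sqrt{\frac{2H\,\Gamma(3/2-H)}{\Gamma(H+1/2)\,\Gamma(2-2H)}}\,(H-\tfrac12)$, $$K_H(t,s)=c(H)\,s^{\frac12-H}\int_s^t \frac{v^{H-\frac12}}{(v-s)^{\frac32-H}}\,dv\quad(0<s<t),\qquad K_H(t,s)=0\quad(s\ge t),$$ $\mathbf 1_t=\mathbf 1_{[0,t)}$ and $L(t,s)=a\mathbf 1_t(s)+bK_H(t,s)$. Let $X=aW+bB^H$ be the completely correlated mixed fractional Brownian motion, where $W=(W_t)_{t\ge0}$ is a Brownian motion and $B^H_t=\int_0^tK_H(t,s)\,dW_s$, and let $$R(t,s)=a^2(t\wedge s)+ab\int_0^{t\wedge s}[K_H(t,v)+K_H(s,v)]\,dv+\tfrac{b^2}{2}\left[t^{2H}+s^{2H}-|t-s|^{2H}\right]$$ be its covariance function. Fix $u\ge0$ and let $\mathcal F^X_u=\sigma(X_s:s\le u)$. For $f\in L^2([0,u])$ the Wiener integral $\int_0^uf(s)\,dX_s$ is the $L^2(\mathbb P)$-limit of $\sum_ic_iX_{t_i}$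 along step functions $\sum_ic_i\mathbf 1_{t_i}$, $t_i\in[0,u]$, that converge to $f$ in $L^2([0,u])$. Theorem. (i) There is exactly one bounded linear operator $\mathrm L^*$ on $L^2([0,u])$ with $\mathrm L^*\mathbf 1_t=L(t,\cdot)$ for all $t\in[0,u]$, and it has a bounded inverse. For $t\ge u$ let $\Psi(t,\cdot|u)=(\mathrm L^*)^{-1}[L(t,\cdot)-L(u,\cdot)]\in L^2([0,u])$. (ii) For every $t\ge u$ the Wiener integral $\int_0^u\Psi(t,s|u)\,dX_s$ exists, and almost surely $$\hat m_t(u):=\mathbb E[X_t|\mathcal F^X_u]=X_u+\int_0^u\Psi(t,s|u)\,dX_s .$$ (iii) For all $s,t\ge u$, almost surely $$\operatorname{Cov}[X_t,X_s|\mathcal F^X_u]=\hat R(t,s|u):=R(t,s)-\int_0^uL(t,v)L(s,v)\,dv,$$ which is deterministic. (iv) Given $\mathcal F^X_u$, the future process $(X_t)_{t\ge u}$ is Gaussian with mean $\hat m_t(u)$ and covariance $\hat R(t,s|u)$: it has a regular conditional law $\kappa_\omega$ on $\mathbb R^{[u,\infty)}$ given $\mathcal F^X_u$ such that for every $\omega$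 the coordinate process is Gaussian under $\kappa_\omega$ with covariance function $\hat R(\cdot,\cdot|u)$, and for every $t\ge u$ its mean at $t$ equals $\hat m_t(u)(\omega)$ for almost every $\omega$. -/

import Mathlib

open MeasureTheory ProbabilityTheory Filter Topology
open scoped NNReal ENNReal

noncomputable section

namespace CcmfBm

/-- The constant `c(H)` of the Molchan–Golosov kernel. -/
def c (H : ℝ) : ℝ :=
  Real.sqrt (2 * H * Real.Gamma (3 / 2 - H) / (Real.Gamma (H + 1 / 2) * Real.Gamma (2 - 2 * H))) *
    (H - 1 / 2)

/-- The Molchan–Golosov kernel `K_H(t,s)`, a Volterra kernel on `0 < s < t`. (Its value at the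
single point `s = 0`, where the formula has no meaning, is irrelevant.) -/
def KH (H t s : ℝ) : ℝ :=
  if s < t then
    c H * (1 / s ^ (H - 1 / 2)) * ∫ v in s..t, v ^ (H - 1 / 2) / (v - s) ^ (3 / 2 - H)
  else 0

/-- The indicator function `1_t = 1_{[0,t)}`. -/
def ind (t s : ℝ) : ℝ := (Set.Ico 0 t).indicator 1 s

/-- The kernel `L(t,s) = a 1_t(s) + b K_H(t,s)`. -/
def L (H a b t s : ℝ) : ℝ := a * ind t s + b * KH H t s

/-- The covariance function `R_H` of fractional Brownian motion. -/
def RH (H t s : ℝ) : ℝ := 1 / 2 * (t ^ (2 * H) + s ^ (2 * H) - |t - s| ^ (2 * H))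

/-- The covariance function `R` of the completely correlated mixed fractional Brownian motion. -/
def R (H a b t s : ℝ) : ℝ :=
  a ^ 2 * min t s + a * b * (∫ v in (0 : ℝ)..(min t s), (KH H t v + KH H s v)) + b ^ 2 * RH H t s

/-- A linear combination `φ` of times `t` stands for the step function `∑ φ(t) 1_t`. -/
def stepFun (φ : ℝ≥0 →₀ ℝ) (s : ℝ) : ℝ := φ.sum fun t r => r * ind t s

/-- The elementary integral `∑ φ(t) Z_t` of the step function `∑ φ(t) 1_t` against `Z`. -/
def stepIntegral {Ω : Type*} (Z : ℝ≥0 → Ω → ℝ) (φ : ℝ≥0 →₀ ℝ) (ω : Ω) : ℝ :=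
  φ.sum fun t r => r * Z t ω

/-- Lebesgue measure on `[0,u]`. -/
abbrev lebesgueOn (u : ℝ≥0) : Measure ℝ := volume.restrict (Set.Icc (0 : ℝ) u)

/-- The Hilbert space `L²([0,u])`. -/
abbrev L2 (u : ℝ≥0) : Type := Lp ℝ 2 (lebesgueOn u)

/-- `Y` is (a version of) the Wiener integral `∫_0^u f(s) dZ_s`: there are step functions
`φ_n = ∑ φ_n(t) 1_t` with jump times `t ≤ u` that converge to `f` in `L²([0,u])` and whose
elementary integrals `∑ φ_n(t) Z_t` converge to `Y` in `L²(P)`. Since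
`‖∑ φ(t) 1_t‖_Λ = ‖∑ φ(t) Z_t‖_{L²(P)}` for the norm generated by the covariance of `Z`, the
second convergence makes `φ_n` Cauchy in the integrand space `Λ`, and the first identifies its
limit there with the function `f`. -/
def IsWienerIntegral {Ω : Type*} [MeasurableSpace Ω] (Z : ℝ≥0 → Ω → ℝ) (P : Measure Ω)
    (u : ℝ≥0) (f : ℝ → ℝ) (Y : Ω → ℝ) : Prop :=
  MemLp f 2 (lebesgueOn u) ∧ MemLp Y 2 P ∧
    ∃ φ : ℕ → (ℝ≥0 →₀ ℝ), (∀ n, ∀ t ∈ (φ n).support, t ≤ u) ∧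
      Tendsto (fun n => eLpNorm (fun s => f s - stepFun (φ n) s) 2 (lebesgueOn u)) atTop (𝓝 0) ∧
      Tendsto (fun n => eLpNorm (fun ω => Y ω - stepIntegral Z (φ n) ω) 2 P) atTop (𝓝 0)

/-- `X` is a completely correlated mixed fractional Brownian motion: `X = a W + b B^H`, where `W`
is a Brownian motion and `B^H_t = ∫_0^t K_H(t,s) dW_s`. Brownian motion is here the centered
Gaussian process with covariance `min t s`; continuity of the paths is not required. -/
def IsCcmfBm {Ω : Type*} [MeasurableSpace Ω] (H a b : ℝ) (X : ℝ≥0 → Ω → ℝ) (P : Measure Ω) :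
    Prop :=
  ∃ W BH : ℝ≥0 → Ω → ℝ, IsPreBrownianReal W P ∧
    (∀ t, IsWienerIntegral W P t (KH H t) (BH t)) ∧
    ∀ t, X t =ᵐ[P] fun ω => a * W t ω + b * BH t ω

/-- The σ-algebra `F_u^X = σ(X_s : s ≤ u)`. -/
@[reducible]
def sigmaUpTo {Ω : Type*} (X : ℝ≥0 → Ω → ℝ) (u : ℝ≥0) : MeasurableSpace Ω :=
  ⨆ s ≤ u, MeasurableSpace.comap (X s) inferInstance

/-- The bounded operator `A` on `L²([0,u])` is the adjoint associated operator `K^*` of the kernel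
`K` on the interval `[0,u]`: it is the extension of `1_t ↦ K(t,·)`, `t ∈ [0,u]`. As the linear span
of the `1_t` is dense, there is at most one such `A`. -/
def IsAdjointAssociated (K : ℝ → ℝ → ℝ) (u : ℝ≥0) (A : L2 u →L[ℝ] L2 u) : Prop :=
  ∀ t : ℝ, 0 ≤ t → t ≤ u → ∀ f : L2 u, f =ᵐ[lebesgueOn u] ind t → A f =ᵐ[lebesgueOn u] K t

/-- The conditional covariance `R(t,s) - ∫_0^u L(t,v) L(s,v) dv`. -/
def condR (H a b : ℝ) (u t s : ℝ) : ℝ :=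
  R H a b t s - ∫ v in (0 : ℝ)..u, L H a b t v * L H a b s v

/-- `κ` is a regular conditional law of `Y` given the σ-algebra `m`. -/
def IsRegularCondLaw {Ω E : Type*} (m : MeasurableSpace Ω) [mΩ : MeasurableSpace Ω]
    [MeasurableSpace E] (Y : Ω → E) (κ : @Kernel Ω E m _) (P : @Measure Ω mΩ) : Prop :=
  ∀ B : Set E, MeasurableSet B → (fun ω => (κ ω).real B) =ᵐ[P] P⟦Y ⁻¹' B | m⟧

end CcmfBm

end

/-!
Let `I` be the isonormal Gaussian process over `L²(ℝ₊)` generated by the Brownian motion, so that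
`X_t = I(L(t,·))`. The operator `L*` is `a` plus `b` times the Volterra operator
`f ↦ ∫_·^u k(·,v) f(v) dv` with the weakly singular kernel `k(s,v) = ∂K_H(v,s)/∂v`. Conjugation by
the exponential `s ↦ e^{rs}` turns `k(s,v)` into `e^{-r(v-s)} k(s,v)`, whose operator norm tends to
`0` as `r → ∞` by the Schur test with a power weight, so a Neumann series inverts `L*`.

Hence, for `t ≥ u`, `L(t,·) = L(u,·) + L*Ψ(t,·|u) + L(t,·) 1_{[u,∞)}`, the middle term living on
`[0,u]`. Applying `I` splits `X_t` into the `F_u`-measurable part `X_u + ∫_0^u Ψ(t,s|u) dX_s` and a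
residual that is orthogonal to, and therefore independent of, all `X_s` with `s ≤ u`. The Gram
matrix of the residuals is the conditional covariance, and translating their joint law by the
conditional mean gives the regular conditional law.
-/

namespace CcmfBm

section Hilbert

variable {ι E F : Type*} [NormedAddCommGroup E] [InnerProductSpace ℝ E]
  [NormedAddCommGroup F] [InnerProductSpace ℝ F]

theorem inner_linearCombination (v : ι → E) (φ ψ : ι →₀ ℝ) :
    inner ℝ (Finsupp.linearCombination ℝ v φ) (Finsupp.linearCombination ℝ v ψ) =
      φ.sum fun i r => ψ.sum fun j q => r * (q * inner ℝ (v i) (v j)) := by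
  simp only [Finsupp.linearCombination_apply, Finsupp.sum, sum_inner, inner_sum,
    inner_smul_left, inner_smul_right, conj_trivial, Finset.mul_sum]
  rw [Finset.sum_comm]
  exact Finset.sum_congr rfl fun i _ => Finset.sum_congr rfl fun j _ => by ring

theorem denseRange_linearCombination {v : ι → E}
    (hv : (Submodule.span ℝ (Set.range v)).topologicalClosure = ⊤) :
    DenseRange (Finsupp.linearCombination ℝ v) := by
  rw [DenseRange, ← LinearMap.coe_range, Finsupp.range_linearCombination]
  exact (Submodule.dense_iff_topologicalClosure_eq_top).2 hv

theorem exists_linearIsometry_of_inner_eq [CompleteSpace F] {v : ι → E} {w : ι → F}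
    (hv : (Submodule.span ℝ (Set.range v)).topologicalClosure = ⊤)
    (h : ∀ i j, inner ℝ (w i) (w j) = inner ℝ (v i) (v j)) :
    ∃ I : E →ₗᵢ[ℝ] F, ∀ i, I (v i) = w i := by
  have hd := denseRange_linearCombination hv
  have hnorm (φ : ι →₀ ℝ) :
      ‖Finsupp.linearCombination ℝ w φ‖ = ‖Finsupp.linearCombination ℝ v φ‖ := by
    rw [@norm_eq_sqrt_real_inner E, @norm_eq_sqrt_real_inner F, inner_linearCombination,
      inner_linearCombination]
    simp only [h]
  have hext (φ : ι →₀ ℝ) := LinearMap.extendOfNorm_eq hd ⟨1, fun x => by rw [one_mul, hnorm]⟩ φ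
  refine ⟨⟨((Finsupp.linearCombination ℝ w).extendOfNorm
    (Finsupp.linearCombination ℝ v)).toLinearMap, fun x => ?_⟩, fun i => ?_⟩
  · refine hd.induction ?_ (isClosed_eq (by fun_prop) (by fun_prop)) x
    rintro _ ⟨φ, rfl⟩
    simpa [hext] using hnorm φ
  · simpa using hext (Finsupp.single i 1)

end Hilbert

section Lp

variable {α β ι : Type*} {mα : MeasurableSpace α} {μ : Measure α} {mβ : MeasurableSpace β}
  {ν : Measure β} {p : ℝ≥0∞}

theorem coeFn_linearCombination {v : ι → Lp ℝ p μ} {F : ι → α → ℝ} {φ : ι →₀ ℝ}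
    (hF : ∀ i ∈ φ.support, v i =ᵐ[μ] F i) :
    Finsupp.linearCombination ℝ v φ =ᵐ[μ] fun x => φ.sum fun i r => r * F i x := by
  rw [Finsupp.linearCombination_apply, Finsupp.sum]
  refine (Lp.coeFn_finsetSum _ _).trans ?_
  have hterm : ∀ᵐ x ∂μ, ∀ i : φ.support, (φ i • v i : Lp ℝ p μ) x = φ i * F i x := by
    refine ae_all_iff.2 fun i => ?_
    filter_upwards [Lp.coeFn_smul (φ i) (v i), hF i i.2] with x hsmul hx
    rw [hsmul, Pi.smul_apply, hx, smul_eq_mul]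
  filter_upwards [hterm] with x hx
  rw [Finset.sum_apply, Finsupp.sum]
  exact Finset.sum_congr rfl fun i hi => hx ⟨i, hi⟩

theorem inner_eq_integral_mul {F G : Lp ℝ 2 μ} {f g : α → ℝ} (hf : F =ᵐ[μ] f) (hg : G =ᵐ[μ] g) :
    inner ℝ F G = ∫ x, f x * g x ∂μ := by
  rw [L2.inner_def]
  refine integral_congr_ae ?_
  filter_upwards [hf, hg] with x hfx hgx
  simp [hfx, hgx, mul_comm]

theorem tendsto_Lp_iff_tendsto_eLpNorm_sub [Fact (1 ≤ p)] {f : Lp ℝ p μ} {F : ℕ → Lp ℝ p μ}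
    {g : α → ℝ} {G : ℕ → α → ℝ} (hf : f =ᵐ[μ] g) (hF : ∀ n, F n =ᵐ[μ] G n) :
    Tendsto F atTop (𝓝 f) ↔
      Tendsto (fun n => eLpNorm (fun x => g x - G n x) p μ) atTop (𝓝 0) := by
  rw [Lp.tendsto_Lp_iff_tendsto_eLpNorm']
  refine tendsto_congr fun n => ?_
  rw [eLpNorm_sub_comm]
  exact eLpNorm_congr_ae (hf.sub (hF n))

theorem exists_continuousLinearMap_coeFn_ae_eq {𝕜 E F : Type*} [NontriviallyNormedField 𝕜]
    [SeminormedAddCommGroup E] [NormedSpace 𝕜 E] [NormedAddCommGroup F] [NormedSpace 𝕜 F]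
    [Fact (1 ≤ p)] {Φ : E → β → F} (hadd : ∀ f g, Φ (f + g) =ᵐ[ν] Φ f + Φ g)
    (hsmul : ∀ (r : 𝕜) (f), Φ (r • f) =ᵐ[ν] r • Φ f)
    (hmeas : ∀ f, AEStronglyMeasurable (Φ f) ν) {C : ℝ≥0}
    (hC : ∀ f, eLpNorm (Φ f) p ν ≤ C * ‖f‖ₑ) :
    ∃ T : E →L[𝕜] Lp F p ν, (∀ f, T f =ᵐ[ν] Φ f) ∧ ‖T‖ ≤ C := by
  have hmem (f : E) : MemLp (Φ f) p ν := ⟨hmeas f, (hC f).trans_lt (by finiteness)⟩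
  let T : E →ₗ[𝕜] Lp F p ν :=
    { toFun := fun f => (hmem f).toLp
      map_add' := fun f g => by rw [← MemLp.toLp_add, MemLp.toLp_eq_toLp_iff]; exact hadd f g
      map_smul' := fun r f => by
        rw [RingHom.id_apply, ← MemLp.toLp_const_smul, MemLp.toLp_eq_toLp_iff]
        exact hsmul r f }
  refine ⟨T.mkContinuous C fun f => ?_, fun f => (hmem f).coeFn_toLp,
    LinearMap.mkContinuous_norm_le _ C.coe_nonneg _⟩
  calc ‖(hmem f).toLp‖ = (eLpNorm (Φ f) p ν).toReal := Lp.norm_toLp _ _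
    _ ≤ (C * ‖f‖ₑ).toReal := ENNReal.toReal_mono (by finiteness) (hC f)
    _ = C * ‖f‖ := by rw [ENNReal.toReal_mul, ENNReal.coe_toReal, toReal_enorm]

end Lp

section Schur

variable {α β : Type*} {mα : MeasurableSpace α} {μ : Measure α} {mβ : MeasurableSpace β}
  {ν : Measure β}

theorem sq_lintegral_mul_le {k h F : β → ℝ≥0∞} (hk : AEMeasurable k ν) (hh : AEMeasurable h ν)
    (hF : AEMeasurable F ν) (h0 : ∀ᵐ y ∂ν, h y ≠ 0) (htop : ∀ᵐ y ∂ν, h y ≠ ∞) :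
    (∫⁻ y, k y * F y ∂ν) ^ 2 ≤ (∫⁻ y, k y * h y ∂ν) * ∫⁻ y, k y * (F y ^ 2 / h y) ∂ν := by
  have hsplit : ∀ᵐ y ∂ν, k y * F y =
      (k y * h y) ^ (1 / 2 : ℝ) * (k y * (F y ^ 2 / h y)) ^ (1 / 2 : ℝ) := by
    filter_upwards [h0, htop] with y h0y hty
    have : k y * h y * (k y * (F y ^ 2 / h y)) = (k y * F y) ^ (2 : ℝ) := by
      rw [ENNReal.rpow_two, mul_mul_mul_comm, ENNReal.mul_div_cancel h0y hty]
      ring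
    rw [← ENNReal.mul_rpow_of_nonneg _ _ (by norm_num), this, ← ENNReal.rpow_mul]
    norm_num
  have hholder := ENNReal.lintegral_mul_norm_pow_le (hk.mul hh) (hk.mul ((hF.pow_const 2).div hh))
    (p := 1 / 2) (q := 1 / 2) (by norm_num) (by norm_num) (by norm_num)
  simp only [Pi.mul_apply, Pi.div_apply] at hholder
  rw [← lintegral_congr_ae hsplit] at hholder
  calc _ ≤ _ := pow_le_pow_left₀ zero_le hholder 2
    _ = _ := by
      rw [mul_pow, ← ENNReal.rpow_two, ← ENNReal.rpow_two, ← ENNReal.rpow_mul, ← ENNReal.rpow_mul]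
      norm_num

variable [SFinite ν]

theorem ae_integrable_of_lintegral_sq_lintegral_enorm_ne_top {F : α → β → ℝ}
    (hF : Measurable (Function.uncurry F))
    (hfin : ∫⁻ x, (∫⁻ y, ‖F x y‖ₑ ∂ν) ^ 2 ∂μ ≠ ∞) : ∀ᵐ x ∂μ, Integrable (F x) ν := by
  have hm : Measurable fun x => (∫⁻ y, ‖F x y‖ₑ ∂ν) ^ 2 :=
    (Measurable.lintegral_prod_right' hF.enorm).pow_const 2
  filter_upwards [ae_lt_top hm hfin] with x hx
  refine ⟨hF.of_uncurry_left.aestronglyMeasurable, ?_⟩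
  rw [HasFiniteIntegral]
  contrapose! hx
  rw [top_le_iff.1 hx]
  simp

variable [SFinite μ] {g : α → ℝ≥0∞} {h : β → ℝ≥0∞}

theorem lintegral_sq_lintegral_le_of_schur {k : α → β → ℝ≥0∞} (hk : Measurable (Function.uncurry k))
    (hg : Measurable g) (hh : Measurable h) (h0 : ∀ᵐ y ∂ν, h y ≠ 0) (htop : ∀ᵐ y ∂ν, h y ≠ ∞)
    {A B : ℝ≥0∞} (hA : ∀ᵐ x ∂μ, ∫⁻ y, k x y * h y ∂ν ≤ A * g x)
    (hB : ∀ᵐ y ∂ν, ∫⁻ x, k x y * g x ∂μ ≤ B * h y) {F : β → ℝ≥0∞} (hF : AEMeasurable F ν) :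
    ∫⁻ x, (∫⁻ y, k x y * F y ∂ν) ^ 2 ∂μ ≤ A * B * ∫⁻ y, F y ^ 2 ∂ν := by
  have hw : AEMeasurable (fun y => F y ^ 2 / h y) ν := (hF.pow_const 2).div hh.aemeasurable
  calc ∫⁻ x, (∫⁻ y, k x y * F y ∂ν) ^ 2 ∂μ
      ≤ ∫⁻ x, A * g x * ∫⁻ y, k x y * (F y ^ 2 / h y) ∂ν ∂μ := by
        refine lintegral_mono_ae ?_
        filter_upwards [hA] with x hx
        exact (sq_lintegral_mul_le hk.of_uncurry_left.aemeasurable hh.aemeasurable hF h0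
          htop).trans (mul_le_mul_left hx _)
    _ = ∫⁻ x, ∫⁻ y, A * (F y ^ 2 / h y) * (k x y * g x) ∂ν ∂μ := by
        refine lintegral_congr fun x => ?_
        have hkw : AEMeasurable (fun y => k x y * (F y ^ 2 / h y)) ν :=
          hk.of_uncurry_left.aemeasurable.mul hw
        rw [← lintegral_const_mul'' _ hkw]
        exact lintegral_congr fun y => by ring
    _ = ∫⁻ y, ∫⁻ x, A * (F y ^ 2 / h y) * (k x y * g x) ∂μ ∂ν :=
        lintegral_lintegral_swap (((hw.const_mul A).comp_snd).mul
          (hk.mul (hg.comp measurable_fst)).aemeasurable)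
    _ = ∫⁻ y, A * (F y ^ 2 / h y) * ∫⁻ x, k x y * g x ∂μ ∂ν :=
        lintegral_congr fun y => lintegral_const_mul _ (hk.of_uncurry_right.mul hg)
    _ ≤ ∫⁻ y, A * B * F y ^ 2 ∂ν := by
        refine lintegral_mono_ae ?_
        filter_upwards [hB, h0, htop] with y hy h0y hty
        calc _ ≤ A * (F y ^ 2 / h y) * (B * h y) := by gcongr
          _ = A * B * (F y ^ 2 / h y * h y) := by ring
          _ = _ := by rw [ENNReal.div_mul_cancel h0y hty]
    _ = A * B * ∫⁻ y, F y ^ 2 ∂ν := lintegral_const_mul'' _ (hF.pow_const 2)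

/-- `A` is the integral operator `(A f)(x) = ∫ k(x,y) f(y) dμ(y)` on `L²(μ)`. -/
def IsIntegralOperator (μ : Measure α) (k : α → α → ℝ) (A : Lp ℝ 2 μ →L[ℝ] Lp ℝ 2 μ) : Prop :=
  ∀ f : Lp ℝ 2 μ, A f =ᵐ[μ] fun x => ∫ y, k x y * f y ∂μ

theorem lintegral_sq_lintegral_enorm_mul_le_of_schur {k : α → α → ℝ}
    (hk : Measurable (Function.uncurry k)) {h : α → ℝ≥0∞} (hh : Measurable h)
    (h0 : ∀ᵐ x ∂μ, h x ≠ 0) (htop : ∀ᵐ x ∂μ, h x ≠ ∞) {A B : ℝ≥0∞}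
    (hA : ∀ᵐ x ∂μ, ∫⁻ y, ‖k x y‖ₑ * h y ∂μ ≤ A * h x)
    (hB : ∀ᵐ y ∂μ, ∫⁻ x, ‖k x y‖ₑ * h x ∂μ ≤ B * h y) (f : Lp ℝ 2 μ) :
    ∫⁻ x, (∫⁻ y, ‖k x y * f y‖ₑ ∂μ) ^ 2 ∂μ ≤ A * B * ‖f‖ₑ ^ 2 := by
  have hsq : ‖f‖ₑ ^ 2 = ∫⁻ y, ‖f y‖ₑ ^ 2 ∂μ := by
    rw [Lp.enorm_def, eLpNorm_eq_lintegral_rpow_enorm_toReal (by norm_num) (by norm_num),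
      ← ENNReal.rpow_natCast, ← ENNReal.rpow_mul]
    norm_num
  simp only [hsq, enorm_mul]
  exact lintegral_sq_lintegral_le_of_schur (k := fun x y => ‖k x y‖ₑ) hk.enorm hh hh h0 htop hA hB
    (Lp.aestronglyMeasurable f).enorm

theorem exists_isIntegralOperator_of_schur {k : α → α → ℝ} (hk : Measurable (Function.uncurry k))
    {h : α → ℝ≥0∞} (hh : Measurable h) (h0 : ∀ᵐ x ∂μ, h x ≠ 0) (htop : ∀ᵐ x ∂μ, h x ≠ ∞)
    {A B : ℝ≥0} (hA : ∀ᵐ x ∂μ, ∫⁻ y, ‖k x y‖ₑ * h y ∂μ ≤ A * h x)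
    (hB : ∀ᵐ y ∂μ, ∫⁻ x, ‖k x y‖ₑ * h x ∂μ ≤ B * h y) :
    ∃ T : Lp ℝ 2 μ →L[ℝ] Lp ℝ 2 μ, IsIntegralOperator μ k T ∧ ‖T‖ ≤ NNReal.sqrt (A * B) := by
  have hsq := lintegral_sq_lintegral_enorm_mul_le_of_schur hk hh h0 htop hA hB
  have hkf (f : Lp ℝ 2 μ) : Measurable (Function.uncurry fun x y => k x y * f y) :=
    hk.mul ((Lp.stronglyMeasurable f).measurable.comp measurable_snd)
  have hint (f : Lp ℝ 2 μ) : ∀ᵐ x ∂μ, Integrable (fun y => k x y * f y) μ :=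
    ae_integrable_of_lintegral_sq_lintegral_enorm_ne_top (hkf f)
      ((hsq f).trans_lt (by finiteness)).ne
  refine exists_continuousLinearMap_coeFn_ae_eq
    (Φ := fun (f : Lp ℝ 2 μ) x => ∫ y, k x y * f y ∂μ) (fun f g => ?_) (fun r f => ?_)
    (fun f => (hkf f).stronglyMeasurable.integral_prod_right'.aestronglyMeasurable) (fun f => ?_)
  · filter_upwards [hint f, hint g] with x hf hg
    rw [Pi.add_apply, ← integral_add hf hg]
    refine integral_congr_ae ?_
    filter_upwards [Lp.coeFn_add f g] with y hy
    rw [hy, Pi.add_apply, mul_add]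
  · refine Eventually.of_forall fun x => ?_
    simp only [Pi.smul_apply, smul_eq_mul]
    rw [← integral_const_mul]
    refine integral_congr_ae ?_
    filter_upwards [Lp.coeFn_smul r f] with y hy
    rw [hy, Pi.smul_apply, smul_eq_mul]
    ring
  · rw [← ENNReal.pow_le_pow_left_iff two_ne_zero, mul_pow, ← ENNReal.coe_pow, NNReal.sq_sqrt,
      ENNReal.coe_mul, eLpNorm_eq_lintegral_rpow_enorm_toReal (by norm_num) (by norm_num),
      ← ENNReal.rpow_natCast, ← ENNReal.rpow_mul]
    simp only [ENNReal.toReal_ofNat, Nat.cast_ofNat, ENNReal.rpow_ofNat, one_div,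
      inv_mul_cancel₀ (two_ne_zero' ℝ), ENNReal.rpow_one]
    refine (lintegral_mono fun x => ?_).trans (hsq f)
    gcongr
    exact enorm_integral_le_lintegral_enorm _

end Schur

section Gaussian

variable {Ω : Type*} [MeasurableSpace Ω] {P : Measure Ω}

theorem hasLaw_gaussianReal_of_tendstoInMeasure {Y : ℕ → Ω → ℝ}
    {Z : Ω → ℝ} {m : ℕ → ℝ} {m' : ℝ} {v : ℕ → ℝ≥0} {v' : ℝ≥0}
    (hY : ∀ n, HasLaw (Y n) (gaussianReal (m n) (v n)) P) (hm : Tendsto m atTop (𝓝 m'))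
    (hv : Tendsto v atTop (𝓝 v')) (hYZ : TendstoInMeasure P Y atTop Z) :
    HasLaw Z (gaussianReal m' v') P := by
  have := (hY 0).isProbabilityMeasure
  have hZ : AEMeasurable Z P := hYZ.aemeasurable fun n => (hY n).aemeasurable
  have := Measure.isProbabilityMeasure_map hZ
  refine ⟨hZ, Measure.ext_of_charFun (funext fun x => ?_)⟩
  have hlim := ProbabilityMeasure.tendsto_iff_tendsto_charFun.1
    (hYZ.tendstoInDistribution_of_aemeasurable (fun n => (hY n).aemeasurable) hZ).tendsto x
  simp only [ProbabilityMeasure.coe_mk, (hY _).map_eq, charFun_gaussianReal] at hlim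
  refine tendsto_nhds_unique hlim ?_
  rw [charFun_gaussianReal]
  have hm' := (Complex.continuous_ofReal.tendsto m').comp hm
  have hv' := ((Complex.continuous_ofReal.comp NNReal.continuous_coe).tendsto v').comp hv
  exact (Complex.continuous_exp.tendsto _).comp
    (((hm'.const_mul _).mul_const _).sub ((hv'.mul_const _).div_const _))

theorem hasLaw_gaussianReal_of_integral_eq_zero {Y : Lp ℝ 2 P} (hY : HasGaussianLaw Y P)
    (h0 : P[Y] = 0) : HasLaw Y (gaussianReal 0 (‖Y‖₊ ^ 2)) P := by
  have hvar : Var[Y; P] = ‖Y‖ ^ 2 := by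
    rw [variance_of_integral_eq_zero hY.aemeasurable h0, ← real_inner_self_eq_norm_sq,
      inner_eq_integral_mul ae_eq_rfl ae_eq_rfl]
    simp only [sq]
  refine ⟨hY.aemeasurable, ?_⟩
  rw [hY.map_eq_gaussianReal, h0, hvar]
  congr 1
  rw [← NNReal.coe_inj, Real.coe_toNNReal _ (sq_nonneg _), NNReal.coe_pow, coe_nnnorm]

theorem hasLaw_linearCombination {ι : Type*} {W : ι → Ω → ℝ} (hW : IsGaussianProcess W P)
    (hW0 : ∀ i, P[W i] = 0) {w : ι → Lp ℝ 2 P} (hw : ∀ i, w i =ᵐ[P] W i) (φ : ι →₀ ℝ) :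
    HasLaw (Finsupp.linearCombination ℝ w φ)
      (gaussianReal 0 (‖Finsupp.linearCombination ℝ w φ‖₊ ^ 2)) P := by
  have hae := coeFn_linearCombination (φ := φ) fun i _ => hw i
  refine hasLaw_gaussianReal_of_integral_eq_zero ?_ ?_
  · exact ((hW.smul φ).hasGaussianLaw_fun_sum (I := φ.support)).congr hae.symm
  · rw [integral_congr_ae hae]
    simp only [Finsupp.sum]
    rw [integral_finsetSum _ fun i _ => (hW.hasGaussianLaw_eval i).integrable.const_mul _]
    simp [integral_const_mul, hW0]

variable {E : Type*} [NormedAddCommGroup E] [InnerProductSpace ℝ E]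

/-- `I` is an isonormal Gaussian process over the inner product space `E`: an isometry into
`L²(P)` with centered Gaussian values. The covariance of `I f` and `I g` is then `⟪f, g⟫`. -/
def IsIsonormal (I : E →ₗᵢ[ℝ] Lp ℝ 2 P) : Prop :=
  ∀ f, HasLaw (I f) (gaussianReal 0 (‖f‖₊ ^ 2)) P

theorem isIsonormal_of_isGaussianProcess {ι : Type*} {W : ι → Ω → ℝ}
    (hW : IsGaussianProcess W P) (hW0 : ∀ i, P[W i] = 0) {v : ι → E}
    (hv : (Submodule.span ℝ (Set.range v)).topologicalClosure = ⊤)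
    {I : E →ₗᵢ[ℝ] Lp ℝ 2 P} (hI : ∀ i, I (v i) =ᵐ[P] W i) : IsIsonormal I := by
  intro f
  refine (denseRange_linearCombination hv).induction (P := fun f =>
    HasLaw (I f) (gaussianReal 0 (‖f‖₊ ^ 2)) P) ?_ (IsSeqClosed.isClosed fun g f hg hgf => ?_) f
  · rintro _ ⟨φ, rfl⟩
    have hmap : I (Finsupp.linearCombination ℝ v φ) =
        Finsupp.linearCombination ℝ (fun i => I (v i)) φ :=
      Finsupp.apply_linearCombination ℝ I.toLinearMap v φ
    rw [← I.nnnorm_map, hmap]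
    exact hasLaw_linearCombination hW hW0 hI φ
  · exact hasLaw_gaussianReal_of_tendstoInMeasure hg tendsto_const_nhds (hgf.nnnorm.pow 2)
      (tendstoInMeasure_of_tendsto_Lp ((I.continuous.tendsto f).comp hgf))

namespace IsIsonormal

variable {I : E →ₗᵢ[ℝ] Lp ℝ 2 P} (hI : IsIsonormal I)

include hI

theorem integral_eq_zero (f : E) : ∫ ω, I f ω ∂P = 0 := by
  rw [(hI f).integral_eq, integral_id_gaussianReal]

theorem isProbabilityMeasure : IsProbabilityMeasure P := (hI 0).isProbabilityMeasure

theorem isGaussianProcess : IsGaussianProcess (fun f => ⇑(I f)) P := by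
  classical
  refine ⟨fun J => ⟨isGaussian_of_map_eq_gaussianReal fun L => ?_⟩⟩
  have hm : AEMeasurable (fun ω => J.restrict fun f => I f ω) P :=
    aemeasurable_pi_lambda _ fun f => (hI f).aemeasurable
  let φ : J →₀ ℝ := Finsupp.equivFunOnFinite.symm fun f => L (Pi.single f 1)
  have hL : L ∘ (fun ω => J.restrict fun f => I f ω) =ᵐ[P]
      I (Finsupp.linearCombination ℝ (fun f : J => (f : E)) φ) := by
    have hmap := Finsupp.apply_linearCombination ℝ I.toLinearMap (fun f : J => (f : E)) φ
    simp only [LinearIsometry.coe_toLinearMap, Function.comp_def] at hmap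
    rw [hmap]
    filter_upwards [coeFn_linearCombination (v := fun f : J => I f) (φ := φ) fun f _ => ae_eq_rfl]
      with ω hω
    rw [hω, Finsupp.sum_fintype _ _ (by simp), Function.comp_apply]
    conv_lhs => rw [pi_eq_sum_univ' (J.restrict fun f => I f ω)]
    simp [φ, mul_comm]
  rw [AEMeasurable.map_map_of_aemeasurable (by fun_prop) hm]
  exact ⟨_, _, ((hI _).congr hL).map_eq⟩

theorem isGaussianProcess_of_ae_eq {T : Type*} {Z : T → Ω → ℝ} {f : T → E}
    (hZ : ∀ t, Z t =ᵐ[P] I (f t)) : IsGaussianProcess Z P :=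
  (hI.isGaussianProcess.comp_right f).congr fun t => (hZ t).symm

theorem covariance_eq_inner {f g : E} {Y Z : Ω → ℝ} (hY : Y =ᵐ[P] I f) (hZ : Z =ᵐ[P] I g) :
    cov[Y, Z; P] = inner ℝ f g := by
  have := hI.isProbabilityMeasure
  rw [covariance_eq_sub ((Lp.memLp (I f)).ae_eq hY.symm) ((Lp.memLp (I g)).ae_eq hZ.symm),
    integral_congr_ae hY, hI.integral_eq_zero, zero_mul, sub_zero, ← I.inner_map_map,
    inner_eq_integral_mul hY.symm hZ.symm]
  rfl

theorem indepFun_of_inner_eq_zero {S T : Type*} {Y : S → Ω → ℝ} {Z : T → Ω → ℝ} {f : S → E}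
    {g : T → E} (hY : ∀ s, Y s =ᵐ[P] I (f s)) (hZ : ∀ t, Z t =ᵐ[P] I (g t))
    (hfg : ∀ s t, inner ℝ (f s) (g t) = 0) :
    IndepFun (fun ω s => Y s ω) (fun ω t => Z t ω) P := by
  have hYZ : ∀ i, Sum.elim Y Z i =ᵐ[P] I (Sum.elim f g i) := Sum.forall.2 ⟨hY, hZ⟩
  exact IsGaussianProcess.indepFun_of_covariance_eq_zero (hI.isGaussianProcess_of_ae_eq hYZ)
    (fun s => (hI (f s)).aemeasurable.congr (hY s).symm)
    (fun t => (hI (g t)).aemeasurable.congr (hZ t).symm)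
    fun s t => by rw [hI.covariance_eq_inner (hY s) (hZ t), hfg]

end IsIsonormal

end Gaussian

section StepFunctions

variable {S : Set ℝ}

theorem ind_of_le {t s : ℝ} (h : t ≤ s) : ind t s = 0 :=
  Set.indicator_of_notMem (fun hs => absurd hs.2 h.not_gt) _

theorem memLp_ind (t : ℝ) : MemLp (ind t) 2 (volume.restrict S) :=
  (memLp_indicator_const 2 measurableSet_Ico (1 : ℝ) (Or.inr measure_Ico_lt_top.ne)).restrict S

/-- The class of the indicator function `1_t` in `L²(S)`. -/
noncomputable def indLp (S : Set ℝ) (t : ℝ) : Lp ℝ 2 (volume.restrict S) := (memLp_ind t).toLp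

theorem coeFn_indLp (t : ℝ) : indLp S t =ᵐ[volume.restrict S] ind t := (memLp_ind t).coeFn_toLp

theorem coeFn_linearCombination_indLp (φ : ℝ≥0 →₀ ℝ) :
    Finsupp.linearCombination ℝ (fun t : ℝ≥0 => indLp S t) φ =ᵐ[volume.restrict S] stepFun φ :=
  coeFn_linearCombination fun t _ => coeFn_indLp (t : ℝ)

theorem ae_eq_zero_of_forall_intervalIntegral_eq_zero {E : Type*} [NormedAddCommGroup E]
    [NormedSpace ℝ E] [CompleteSpace E] {f : ℝ → E} (hf : LocallyIntegrable f volume) {a : ℝ}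
    (h : ∀ t, ∫ x in a..t, f x = 0) : f =ᵐ[volume] 0 := by
  filter_upwards [_root_.LocallyIntegrable.ae_hasDerivAt_integral hf] with x hx
  have hder := hx a
  simp only [h] at hder
  exact hder.unique (hasDerivAt_const x 0)

theorem intervalIntegral_indicator_eq (hS : MeasurableSet S) (hS0 : S ⊆ Set.Ici 0) (g : ℝ → ℝ)
    {t : ℝ} (ht : 0 ≤ t) : ∫ x in (0 : ℝ)..t, S.indicator g x = ∫ x in S, ind t x * g x := by
  rw [intervalIntegral.integral_of_le ht, integral_Ioc_eq_integral_Ioo,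
    ← integral_Ico_eq_integral_Ioo, ← integral_indicator measurableSet_Ico,
    ← integral_indicator hS]
  congr 1 with x
  by_cases hx : x ∈ S <;> by_cases hxt : x < t <;>
    simp [hx, hxt, ind, Set.indicator, Set.mem_Ici.1 ∘ @hS0 x]

theorem intervalIntegral_indicator_of_nonpos (hS0 : S ⊆ Set.Ici 0) (g : ℝ → ℝ) {t : ℝ}
    (ht : t ≤ 0) : ∫ x in (0 : ℝ)..t, S.indicator g x = 0 := by
  rw [intervalIntegral.integral_of_ge ht, integral_Ioc_eq_integral_Ioo, neg_eq_zero]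
  refine setIntegral_eq_zero_of_forall_eq_zero fun x hx => Set.indicator_of_notMem (fun hxS => ?_) g
  exact absurd (hS0 hxS) (not_le.2 hx.2)

theorem topologicalClosure_span_range_indLp (hS : MeasurableSet S) (hS0 : S ⊆ Set.Ici 0) :
    (Submodule.span ℝ (Set.range fun t : ℝ≥0 => indLp S t)).topologicalClosure = ⊤ := by
  rw [Submodule.topologicalClosure_eq_top_iff, Submodule.eq_bot_iff]
  intro g hg
  have horth (t : ℝ≥0) : ∫ x in S, ind t x * g x = 0 := by
    rw [← inner_eq_integral_mul (coeFn_indLp (t : ℝ)) ae_eq_rfl]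
    exact (Submodule.mem_orthogonal _ _).1 hg _ (Submodule.subset_span ⟨t, rfl⟩)
  have hloc : LocallyIntegrable (S.indicator g) volume :=
    ((memLp_indicator_iff_restrict hS).2 (Lp.memLp g)).locallyIntegrable (by norm_num)
  have hzero : S.indicator g =ᵐ[volume] 0 := by
    refine ae_eq_zero_of_forall_intervalIntegral_eq_zero hloc (a := 0) fun t => ?_
    rcases le_total 0 t with ht | ht
    · rw [intervalIntegral_indicator_eq hS hS0 g ht]
      exact horth ⟨t, ht⟩
    · exact intervalIntegral_indicator_of_nonpos hS0 g ht
  refine (Lp.eq_zero_iff_ae_eq_zero).2 ((ae_restrict_iff' hS).2 ?_)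
  filter_upwards [hzero] with x hx hxS
  rwa [Set.indicator_of_mem hxS] at hx

theorem indLp_Icc_min (u t : ℝ) : indLp (Set.Icc 0 u) (min t u) = indLp (Set.Icc 0 u) t := by
  refine Lp.ext ((coeFn_indLp _).trans (EventuallyEq.trans ?_ (coeFn_indLp t).symm))
  filter_upwards [ae_restrict_mem measurableSet_Icc, Measure.ae_ne (volume.restrict _) u]
    with x hx hxu
  simp [ind, Set.indicator, lt_of_le_of_ne hx.2 hxu]

theorem topologicalClosure_span_image_indLp_Icc (u : ℝ≥0) :
    (Submodule.span ℝ ((fun t : ℝ≥0 => indLp (Set.Icc 0 u) t) '' Set.Iic u)).topologicalClosure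
      = ⊤ := by
  rw [← topologicalClosure_span_range_indLp measurableSet_Icc Set.Icc_subset_Ici_self]
  congr 2
  refine (Set.image_subset_range _ _).antisymm ?_
  rintro _ ⟨t, rfl⟩
  exact ⟨min t u, min_le_right t u, by simp only [NNReal.coe_min, indLp_Icc_min]⟩

/-- Lebesgue measure on the half-line `[0,∞)`. -/
noncomputable abbrev halfLine : Measure ℝ := volume.restrict (Set.Ici 0)

theorem inner_indLp_indLp (s t : ℝ≥0) :
    inner ℝ (indLp (Set.Ici 0) s) (indLp (Set.Ici 0) t) = min s t := by
  have hmul : (fun x => ind s x * ind t x) =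
      (Set.Ico (0 : ℝ) (min s t)).indicator fun _ => 1 := by
    ext x
    simp only [ind, Set.indicator, Set.mem_Ico, Pi.one_apply, lt_inf_iff]
    split_ifs <;> grind
  rw [inner_eq_integral_mul (coeFn_indLp _) (coeFn_indLp _), hmul,
    integral_indicator measurableSet_Ico, Measure.restrict_restrict measurableSet_Ico,
    Set.inter_eq_left.2 Set.Ico_subset_Ici_self]
  simp

theorem ae_halfLine_pos : ∀ᵐ x ∂halfLine, 0 < x := by
  filter_upwards [ae_restrict_mem measurableSet_Ici, Measure.ae_ne (volume.restrict _) 0]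
    with x hx hx0 using lt_of_le_of_ne hx hx0.symm

theorem ae_lebesgueOn_iff {u : ℝ≥0} {p : ℝ → Prop} :
    (∀ᵐ x ∂lebesgueOn u, p x) ↔ ∀ᵐ x ∂halfLine, x ∈ Set.Icc (0 : ℝ) u → p x := by
  rw [← ae_restrict_iff' measurableSet_Icc, Measure.restrict_restrict measurableSet_Icc,
    Set.inter_eq_left.2 Set.Icc_subset_Ici_self]

theorem exists_extendZero (u : ℝ≥0) :
    ∃ T : L2 u →L[ℝ] Lp ℝ 2 halfLine,
      ∀ f : L2 u, T f =ᵐ[halfLine] (Set.Icc (0 : ℝ) u).indicator f := by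
  have hrestrict : halfLine.restrict (Set.Icc (0 : ℝ) u) = lebesgueOn u := by
    rw [Measure.restrict_restrict measurableSet_Icc, Set.inter_eq_left.2 Set.Icc_subset_Ici_self]
  let Φ (f : L2 u) : ℝ → ℝ := (Set.Icc (0 : ℝ) u).indicator f
  have hadd (f g) : Φ (f + g) =ᵐ[halfLine] Φ f + Φ g := by
    filter_upwards [ae_lebesgueOn_iff.1 (Lp.coeFn_add f g)] with x hx
    by_cases hxu : x ∈ Set.Icc (0 : ℝ) u
    · simp only [Φ, Pi.add_apply, Set.indicator_of_mem hxu, hx hxu]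
    · simp only [Φ, Pi.add_apply, Set.indicator_of_notMem hxu, add_zero]
  have hsmul (r : ℝ) (f) : Φ (r • f) =ᵐ[halfLine] r • Φ f := by
    filter_upwards [ae_lebesgueOn_iff.1 (Lp.coeFn_smul r f)] with x hx
    by_cases hxu : x ∈ Set.Icc (0 : ℝ) u
    · simp only [Φ, Pi.smul_apply, Set.indicator_of_mem hxu, hx hxu]
    · simp only [Φ, Pi.smul_apply, Set.indicator_of_notMem hxu, smul_zero]
  have hmeas (f) : AEStronglyMeasurable (Φ f) halfLine := by
    rw [aestronglyMeasurable_indicator_iff measurableSet_Icc, hrestrict]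
    exact Lp.aestronglyMeasurable f
  have hnorm (f) : eLpNorm (Φ f) 2 halfLine ≤ (1 : ℝ≥0) * ‖f‖ₑ := by
    rw [eLpNorm_indicator_eq_eLpNorm_restrict measurableSet_Icc, hrestrict, ENNReal.coe_one,
      one_mul, Lp.enorm_def]
  obtain ⟨T, hT, -⟩ := exists_continuousLinearMap_coeFn_ae_eq hadd hsmul hmeas hnorm
  exact ⟨T, hT⟩

/-- Extension by zero of a function on `[0,u]` to the half-line. -/
noncomputable def extendZero (u : ℝ≥0) : L2 u →L[ℝ] Lp ℝ 2 halfLine := (exists_extendZero u).choose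

theorem coeFn_extendZero {u : ℝ≥0} (f : L2 u) :
    extendZero u f =ᵐ[halfLine] (Set.Icc (0 : ℝ) u).indicator f :=
  (exists_extendZero u).choose_spec f

theorem extendZero_eq_toLp {u : ℝ≥0} {f : ℝ → ℝ} (hf : MemLp f 2 halfLine)
    (hf0 : ∀ s, (u : ℝ) ≤ s → f s = 0) {g : L2 u} (hg : g =ᵐ[lebesgueOn u] f) :
    extendZero u g = hf.toLp := by
  refine Lp.ext ((coeFn_extendZero g).trans (EventuallyEq.trans ?_ hf.coeFn_toLp.symm))
  filter_upwards [ae_lebesgueOn_iff.1 hg, ae_restrict_mem measurableSet_Ici] with x hgf hx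
  by_cases hxu : x ≤ u
  · rw [Set.indicator_of_mem (s := Set.Icc 0 (u : ℝ)) ⟨hx, hxu⟩, hgf ⟨hx, hxu⟩]
  · rw [Set.indicator_of_notMem (fun h => hxu h.2), hf0 x (not_le.1 hxu).le]

end StepFunctions

section WienerIntegral

variable {Ω : Type*} [mΩ : MeasurableSpace Ω] {P : Measure Ω}

theorem exists_wienerIsometry {W : ℝ≥0 → Ω → ℝ} (hW : IsPreBrownianReal W P) :
    ∃ I : Lp ℝ 2 halfLine →ₗᵢ[ℝ] Lp ℝ 2 P,
      IsIsonormal I ∧ ∀ t : ℝ≥0, I (indLp (Set.Ici 0) t) =ᵐ[P] W t := by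
  have := hW.isGaussianProcess.isProbabilityMeasure
  have hmem (t : ℝ≥0) : MemLp (W t) 2 P := (hW.isGaussianProcess.hasGaussianLaw_eval t).memLp_two
  have htotal := topologicalClosure_span_range_indLp measurableSet_Ici (subset_refl (Set.Ici 0))
  obtain ⟨I, hI⟩ := exists_linearIsometry_of_inner_eq htotal (w := fun t => (hmem t).toLp)
    fun s t => by
      rw [inner_indLp_indLp, inner_eq_integral_mul (hmem s).coeFn_toLp (hmem t).coeFn_toLp,
        ← hW.covariance_eval, covariance_eq_sub (hmem s) (hmem t), hW.integral_eval, zero_mul,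
        sub_zero]
      rfl
  have hIW (t : ℝ≥0) : I (indLp (Set.Ici 0) t) =ᵐ[P] W t := by
    rw [hI]
    exact (hmem t).coeFn_toLp
  exact ⟨I, isIsonormal_of_isGaussianProcess hW.isGaussianProcess hW.integral_eval htotal hIW, hIW⟩

theorem sigmaUpTo_le {Z : ℝ≥0 → Ω → ℝ} (hZ : ∀ t, Measurable (Z t)) (u : ℝ≥0) :
    sigmaUpTo Z u ≤ mΩ :=
  iSup₂_le fun t _ => (hZ t).comap_le

theorem measurable_sigmaUpTo {Ω : Type*} (Z : ℝ≥0 → Ω → ℝ) {t u : ℝ≥0} (ht : t ≤ u) :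
    Measurable[sigmaUpTo Z u] (Z t) :=
  Measurable.mono (comap_measurable (Z t))
    (le_iSup₂ (f := fun s (_ : s ≤ u) => MeasurableSpace.comap (Z s) inferInstance) t ht) le_rfl

theorem sigmaUpTo_eq_comap {Ω : Type*} (Z : ℝ≥0 → Ω → ℝ) (u : ℝ≥0) :
    sigmaUpTo Z u =
      MeasurableSpace.comap (fun ω (s : {s : ℝ≥0 // s ≤ u}) => Z s ω) inferInstance := by
  simp only [MeasurableSpace.pi, MeasurableSpace.comap_iSup, MeasurableSpace.comap_comp,
    Function.comp_def, sigmaUpTo, iSup_subtype]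

theorem stronglyMeasurable_stepIntegral {Z : ℝ≥0 → Ω → ℝ} {φ : ℝ≥0 →₀ ℝ}
    (hZ : ∀ t ∈ φ.support, Measurable (Z t)) : StronglyMeasurable (stepIntegral Z φ) :=
  (Finset.measurable_fun_sum _ fun t ht => (hZ t ht).const_mul (φ t)).stronglyMeasurable

variable {u : ℝ≥0} {Z : ℝ≥0 → Ω → ℝ} {J : L2 u →L[ℝ] Lp ℝ 2 P}

/-- The bounded operator `J` maps `1_t` to `Z_t` for `t ≤ u`. As the step functions are dense,
such an operator is the Wiener integral against `Z` on `[0,u]`. -/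
def IsWienerOperator (Z : ℝ≥0 → Ω → ℝ) (P : Measure Ω) (u : ℝ≥0) (J : L2 u →L[ℝ] Lp ℝ 2 P) :
    Prop :=
  ∀ t : ℝ≥0, t ≤ u → J (indLp (Set.Icc 0 u) t) =ᵐ[P] Z t

theorem exists_tendsto_linearCombination_indLp (g : L2 u) :
    ∃ φ : ℕ → (ℝ≥0 →₀ ℝ), (∀ n, ∀ t ∈ (φ n).support, t ≤ u) ∧
      Tendsto (fun n => Finsupp.linearCombination ℝ (fun t : ℝ≥0 => indLp (Set.Icc 0 u) t) (φ n))
        atTop (𝓝 g) := by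
  have hdense := Submodule.dense_iff_topologicalClosure_eq_top.2
    (topologicalClosure_span_image_indLp_Icc u)
  obtain ⟨x, hx, hxg⟩ := mem_closure_iff_seq_limit.1 (hdense g)
  choose φ hφ hφx using fun n => (Finsupp.mem_span_image_iff_linearCombination ℝ).1 (hx n)
  exact ⟨φ, fun n t ht => hφ n ht, by simpa only [hφx] using hxg⟩

namespace IsWienerOperator

variable (hJ : IsWienerOperator Z P u J)

include hJ

theorem map_linearCombination {φ : ℝ≥0 →₀ ℝ} (hφ : ∀ t ∈ φ.support, t ≤ u) :
    J (Finsupp.linearCombination ℝ (fun t : ℝ≥0 => indLp (Set.Icc 0 u) t) φ)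
      =ᵐ[P] stepIntegral Z φ := by
  have hmap : J (Finsupp.linearCombination ℝ (fun t : ℝ≥0 => indLp (Set.Icc 0 u) t) φ) =
      Finsupp.linearCombination ℝ (fun t : ℝ≥0 => J (indLp (Set.Icc 0 u) t)) φ :=
    Finsupp.apply_linearCombination ℝ J.toLinearMap _ φ
  rw [hmap]
  exact coeFn_linearCombination fun t ht => hJ t (hφ t ht)

theorem isWienerIntegral (g : L2 u) : IsWienerIntegral Z P u g (J g) := by
  obtain ⟨φ, hφ, hφg⟩ := exists_tendsto_linearCombination_indLp g
  exact ⟨Lp.memLp g, Lp.memLp (J g), φ, hφ,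
    (tendsto_Lp_iff_tendsto_eLpNorm_sub ae_eq_rfl
      fun n => coeFn_linearCombination_indLp (φ n)).1 hφg,
    (tendsto_Lp_iff_tendsto_eLpNorm_sub ae_eq_rfl
      fun n => hJ.map_linearCombination (hφ n)).1 ((J.continuous.tendsto g).comp hφg)⟩

theorem ae_eq_of_isWienerIntegral {f : ℝ → ℝ} {Y : Ω → ℝ} (hY : IsWienerIntegral Z P u f Y)
    {g : L2 u} (hg : g =ᵐ[lebesgueOn u] f) : Y =ᵐ[P] J g := by
  obtain ⟨-, hYmem, φ, hφ, hφf, hφY⟩ := hY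
  have hg_lim := (tendsto_Lp_iff_tendsto_eLpNorm_sub hg
    fun n => coeFn_linearCombination_indLp (φ n)).2 hφf
  have hY_lim := (tendsto_Lp_iff_tendsto_eLpNorm_sub hYmem.coeFn_toLp
    fun n => hJ.map_linearCombination (hφ n)).2 hφY
  rw [tendsto_nhds_unique ((J.continuous.tendsto g).comp hg_lim) hY_lim]
  exact hYmem.coeFn_toLp.symm

theorem aestronglyMeasurable (hZ : ∀ t, Measurable (Z t)) (g : L2 u) :
    AEStronglyMeasurable[sigmaUpTo Z u] (J g) P := by
  obtain ⟨φ, hφ, hφg⟩ := exists_tendsto_linearCombination_indLp g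
  refine (isClosed_aestronglyMeasurable (sigmaUpTo_le hZ u)).mem_of_tendsto
    ((J.continuous.tendsto g).comp hφg) (Eventually.of_forall fun n => ?_)
  exact ⟨stepIntegral Z (φ n), @stronglyMeasurable_stepIntegral Ω (sigmaUpTo Z u) Z (φ n)
    fun t ht => measurable_sigmaUpTo Z (hφ n t ht), hJ.map_linearCombination (hφ n)⟩

end IsWienerOperator

end WienerIntegral

section WeightedIntegralOperator

variable {α : Type*} {mα : MeasurableSpace α} {μ : Measure α}

theorem exists_mulOperator {g : α → ℝ} (hg : AEStronglyMeasurable g μ) {C : ℝ≥0}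
    (hC : ∀ᵐ x ∂μ, ‖g x‖₊ ≤ C) :
    ∃ M : Lp ℝ 2 μ →L[ℝ] Lp ℝ 2 μ, ∀ f : Lp ℝ 2 μ, M f =ᵐ[μ] fun x => g x * f x := by
  let Φ (f : Lp ℝ 2 μ) : α → ℝ := fun x => g x * f x
  have hadd (f h) : Φ (f + h) =ᵐ[μ] Φ f + Φ h := by
    filter_upwards [Lp.coeFn_add f h] with x hx
    simp only [Φ, hx, Pi.add_apply, mul_add]
  have hsmul (r : ℝ) (f) : Φ (r • f) =ᵐ[μ] r • Φ f := by
    filter_upwards [Lp.coeFn_smul r f] with x hx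
    simp only [Φ, hx, Pi.smul_apply, smul_eq_mul, mul_left_comm]
  have hbound (f) : eLpNorm (Φ f) 2 μ ≤ C * ‖f‖ₑ := by
    rw [Lp.enorm_def]
    refine eLpNorm_le_nnreal_smul_eLpNorm_of_ae_le_mul ?_ 2
    filter_upwards [hC] with x hx
    rw [nnnorm_mul]
    gcongr
  obtain ⟨M, hM, -⟩ := exists_continuousLinearMap_coeFn_ae_eq hadd hsmul
    (fun f => hg.mul (Lp.aestronglyMeasurable f)) hbound
  exact ⟨M, hM⟩

theorem exists_mulEquiv {g : α → ℝ} (hg : AEStronglyMeasurable g μ) {C C' : ℝ≥0}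
    (hC : ∀ᵐ x ∂μ, ‖g x‖₊ ≤ C) (hC' : ∀ᵐ x ∂μ, ‖(g x)⁻¹‖₊ ≤ C') (h0 : ∀ᵐ x ∂μ, g x ≠ 0) :
    ∃ M : Lp ℝ 2 μ ≃L[ℝ] Lp ℝ 2 μ, ∀ f : Lp ℝ 2 μ, M f =ᵐ[μ] fun x => g x * f x := by
  obtain ⟨M, hM⟩ := exists_mulOperator hg hC
  obtain ⟨N, hN⟩ := exists_mulOperator hg.inv₀ hC'
  refine ⟨ContinuousLinearEquiv.equivOfInverse M N (fun f => Lp.ext ?_) fun f => Lp.ext ?_, hM⟩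
  · filter_upwards [hN (M f), hM f, h0] with x hNx hMx hx
    rw [hNx, hMx, Pi.inv_apply, inv_mul_cancel_left₀ hx]
  · filter_upwards [hM (N f), hN f, h0] with x hMx hNx hx
    rw [hMx, hNx, Pi.inv_apply, mul_inv_cancel_left₀ hx]

theorem exists_equiv_smul_add_smul {𝕜 E : Type*} [NontriviallyNormedField 𝕜]
    [NormedAddCommGroup E] [NormedSpace 𝕜 E] [CompleteSpace E] {a b : 𝕜} (ha : a ≠ 0)
    {T : E →L[𝕜] E} (hT : ‖a⁻¹ * b‖ * ‖T‖ < 1) :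
    ∃ B : E ≃L[𝕜] E, ∀ x, B x = a • x + b • T x := by
  have hunit : IsUnit (1 - -((a⁻¹ * b) • T)) :=
    isUnit_one_sub_of_norm_lt_one (by rwa [norm_neg, norm_smul])
  refine ⟨ContinuousLinearEquiv.unitsEquiv 𝕜 E (hunit.smul (Units.mk0 a ha)).unit, fun x => ?_⟩
  change a • (x - -((a⁻¹ * b) • T x)) = _
  rw [sub_neg_eq_add, smul_add, smul_smul, mul_inv_cancel_left₀ ha]

theorem exists_equiv_smul_add_integral {k : α → α → ℝ} {w : α → ℝ}
    (hw : AEStronglyMeasurable w μ) {C C' : ℝ≥0} (hC : ∀ᵐ x ∂μ, ‖w x‖₊ ≤ C)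
    (hC' : ∀ᵐ x ∂μ, ‖(w x)⁻¹‖₊ ≤ C') (h0 : ∀ᵐ x ∂μ, w x ≠ 0) {T : Lp ℝ 2 μ →L[ℝ] Lp ℝ 2 μ}
    (hT : IsIntegralOperator μ (fun x y => w x * k x y * (w y)⁻¹) T) {a b : ℝ} (ha : a ≠ 0)
    (hnorm : ‖a⁻¹ * b‖ * ‖T‖ < 1) :
    ∃ A : Lp ℝ 2 μ ≃L[ℝ] Lp ℝ 2 μ, ∀ f : Lp ℝ 2 μ,
      A f =ᵐ[μ] fun x => a * f x + b * ∫ y, k x y * f y ∂μ := by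
  obtain ⟨M, hM⟩ := exists_mulEquiv hw hC hC' h0
  obtain ⟨B, hB⟩ := exists_equiv_smul_add_smul ha hnorm
  refine ⟨(M.trans B).trans M.symm, fun f => ?_⟩
  set g := M.symm (B (M f))
  have hMg : M g = a • M f + b • T (M f) := (M.apply_symm_apply _).trans (hB _)
  have hg : (fun x => w x * g x) =ᵐ[μ] a • M f + b • T (M f) := by
    refine (hM g).symm.trans ?_
    rw [hMg]
    exact (Lp.coeFn_add _ _).trans ((Lp.coeFn_smul a _).add (Lp.coeFn_smul b _))
  have hTMf : T (M f) =ᵐ[μ] fun x => w x * ∫ y, k x y * f y ∂μ := by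
    filter_upwards [hT (M f)] with x hx
    rw [hx, ← integral_const_mul]
    refine integral_congr_ae ?_
    filter_upwards [hM f, h0] with y hy hwy
    rw [hy]
    field_simp
  change g =ᵐ[μ] _
  filter_upwards [hg, hTMf, hM f, h0] with x hgx hTx hMx hwx
  refine mul_left_cancel₀ hwx ?_
  rw [hgx, Pi.add_apply, Pi.smul_apply, Pi.smul_apply, hTx, hMx, smul_eq_mul, smul_eq_mul]
  ring

end WeightedIntegralOperator

section MolchanGolosovKernel

variable {α : ℝ}

/-- The integrand of the Molchan–Golosov kernel for `α = H - 1/2`: for `0 < s`,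
`K_H(t,s) = c(H) ∫_0^t k_α(s,v) dv` with `k_α(s,v) = s^{-α} v^α (v-s)^{α-1}` for `0 < s < v` and
`k_α(s,v) = 0` otherwise. -/
noncomputable def mgKernel (α s v : ℝ) : ℝ :=
  if 0 < s ∧ s < v then s ^ (-α) * v ^ α * (v - s) ^ (α - 1) else 0

theorem mgKernel_of_mem {s v : ℝ} (hs : s ∈ Set.Ioo 0 v) :
    mgKernel α s v = s ^ (-α) * v ^ α * (v - s) ^ (α - 1) :=
  if_pos hs

theorem mgKernel_of_notMem {s v : ℝ} (hs : s ∉ Set.Ioo 0 v) : mgKernel α s v = 0 :=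
  if_neg hs

theorem mgKernel_nonneg (α s v : ℝ) : 0 ≤ mgKernel α s v := by
  by_cases hs : s ∈ Set.Ioo 0 v
  · have hs0 : 0 < s := hs.1
    have hv : 0 < v := hs0.trans hs.2
    have hsv : 0 < v - s := sub_pos.2 hs.2
    rw [mgKernel_of_mem hs]
    positivity
  · rw [mgKernel_of_notMem hs]

theorem measurable_mgKernel (α : ℝ) : Measurable (Function.uncurry (mgKernel α)) := by
  refine Measurable.ite ?_ (by fun_prop) measurable_const
  exact (measurableSet_lt measurable_const measurable_fst).inter
    (measurableSet_lt measurable_fst measurable_snd)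

theorem setLIntegral_Ioo_mgKernel_mul (v : ℝ) (g : ℝ → ℝ) :
    ∫⁻ s in Set.Ioo 0 v, ENNReal.ofReal (mgKernel α s v * g s) =
      ∫⁻ s, ENNReal.ofReal (mgKernel α s v * g s) := by
  refine setLIntegral_eq_of_support_subset fun s hs => ?_
  by_contra hs'
  simp [mgKernel_of_notMem hs'] at hs

theorem lintegral_beta {p q : ℝ} (hp : 0 < p) (hq : 0 < q) :
    ∫⁻ w in Set.Ioo (0 : ℝ) 1, ENNReal.ofReal (w ^ (p - 1) * (1 - w) ^ (q - 1)) =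
      ENNReal.ofReal (beta p q) := by
  have hb := beta_pos hp hq
  have hpdf := lintegral_betaPDF_eq_one hp hq
  simp only [lintegral_betaPDF, mul_assoc, ENNReal.ofReal_mul (one_div_pos.2 hb).le] at hpdf
  rw [lintegral_const_mul' _ _ (by finiteness), one_div, ENNReal.ofReal_inv_of_pos hb] at hpdf
  rw [← ENNReal.mul_right_inj (ENNReal.inv_ne_zero.2 ENNReal.ofReal_ne_top)
    (ENNReal.inv_ne_top.2 (ENNReal.ofReal_pos.2 hb).ne'), hpdf,
    ENNReal.inv_mul_cancel (ENNReal.ofReal_pos.2 hb).ne' ENNReal.ofReal_ne_top]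

/-- The change of variable `s ↦ y(x-s)/(x(y-s))`, a Möbius transformation of `(0,x)` onto `(0,1)`
that turns the inner product of `k_α(·,x)` and `k_α(·,y)` into a beta integral. -/
noncomputable def betaSubst (x y s : ℝ) : ℝ := y * (x - s) / (x * (y - s))

section BetaSubst

variable {x y : ℝ}

theorem one_sub_betaSubst {s : ℝ} (hx : x ≠ 0) (hs : y - s ≠ 0) :
    1 - betaSubst x y s = s * (y - x) / (x * (y - s)) := by
  rw [betaSubst]
  field_simp
  ring

theorem image_betaSubst (hx : 0 < x) (hxy : x < y) :
    betaSubst x y '' Set.Ioo 0 x = Set.Ioo 0 1 := by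
  have hy : 0 < y := hx.trans hxy
  have hD : 0 < y - x := sub_pos.2 hxy
  ext w
  constructor
  · rintro ⟨s, ⟨hs, hsx⟩, rfl⟩
    have : 0 < x - s := sub_pos.2 hsx
    have hys : 0 < y - s := by linarith
    refine ⟨by unfold betaSubst; positivity, sub_pos.1 ?_⟩
    rw [one_sub_betaSubst hx.ne' hys.ne']
    positivity
  · rintro ⟨hw, hw1⟩
    have hden : 0 < y - w * x := by nlinarith
    have : 0 < 1 - w := by linarith
    refine ⟨x * y * (1 - w) / (y - w * x), ⟨by positivity, ?_⟩, ?_⟩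
    · rw [div_lt_iff₀ hden]
      nlinarith [mul_pos (mul_pos hx hw) hD]
    · have hxs : x - x * y * (1 - w) / (y - w * x) = x * w * (y - x) / (y - w * x) := by
        rw [eq_div_iff hden.ne', sub_mul, div_mul_cancel₀ _ hden.ne']
        ring
      have hys : y - x * y * (1 - w) / (y - w * x) = y * (y - x) / (y - w * x) := by
        rw [eq_div_iff hden.ne', sub_mul, div_mul_cancel₀ _ hden.ne']
        ring
      rw [betaSubst, hxs, hys, mul_div_assoc', mul_div_assoc', div_div_div_cancel_right₀ hden.ne']
      field_simp

theorem injOn_betaSubst (hx : 0 < x) (hxy : x < y) :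
    Set.InjOn (betaSubst x y) (Set.Ioo 0 x) := by
  rintro s ⟨-, hs⟩ r ⟨-, hr⟩ hsr
  have hy : 0 < y := hx.trans hxy
  have hD : 0 < y - x := sub_pos.2 hxy
  have hys : 0 < y - s := by linarith
  have hyr : 0 < y - r := by linarith
  rw [betaSubst, betaSubst, div_eq_div_iff (by positivity) (by positivity)] at hsr
  have hprod : y * x * (y - x) * (s - r) = 0 := by linear_combination -hsr
  exact sub_eq_zero.1 ((mul_eq_zero.1 hprod).resolve_left (by positivity))

theorem hasDerivAt_betaSubst {s : ℝ} (hx : x ≠ 0) (hs : y - s ≠ 0) :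
    HasDerivAt (betaSubst x y) (-(y * (y - x) / (x * (y - s) ^ 2))) s := by
  have hnum : HasDerivAt (fun s => y * (x - s)) (y * -1) s :=
    ((hasDerivAt_id s).const_sub x).const_mul y
  have hden : HasDerivAt (fun s => x * (y - s)) (x * -1) s :=
    ((hasDerivAt_id s).const_sub y).const_mul x
  refine (hnum.div hden (mul_ne_zero hx hs)).congr_deriv ?_
  field_simp
  ring

theorem deriv_betaSubst_mul_rpow {s : ℝ} (hs : s ∈ Set.Ioo 0 x) (hxy : x < y) :
    |-(y * (y - x) / (x * (y - s) ^ 2))| *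
        (betaSubst x y s ^ (α - 1) * (1 - betaSubst x y s) ^ (1 - 2 * α - 1)) =
      (y - x) ^ (1 - 2 * α) * (mgKernel α s x * mgKernel α s y) := by
  obtain ⟨hs0, hsx⟩ := hs
  have hx : 0 < x := hs0.trans hsx
  have hy : 0 < y := hx.trans hxy
  have hD : 0 < y - x := sub_pos.2 hxy
  have hxs : 0 < x - s := sub_pos.2 hsx
  have hys : 0 < y - s := by linarith
  rw [abs_neg, abs_of_pos (by positivity), one_sub_betaSubst hx.ne' hys.ne', betaSubst,
    mgKernel_of_mem ⟨hs0, hsx⟩, mgKernel_of_mem ⟨hs0, hsx.trans hxy⟩]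
  generalize x - s = A at *
  generalize y - s = B at *
  generalize y - x = D at *
  -- all six factors are positive, so both sides may be compared as exponentials
  rw [← Real.exp_log hs0, ← Real.exp_log hx, ← Real.exp_log hy, ← Real.exp_log hxs,
    ← Real.exp_log hys, ← Real.exp_log hD]
  simp only [sq, ← Real.exp_mul, ← Real.exp_add, ← Real.exp_sub]
  congr 1
  ring

end BetaSubst

theorem lintegral_mgKernel_mul_mgKernel {x y : ℝ} (hα : 0 < α) (hα' : α < 1 / 2) (hx : 0 < x)
    (hxy : x < y) :
    ∫⁻ s, ENNReal.ofReal (mgKernel α s x * mgKernel α s y) =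
      ENNReal.ofReal (beta α (1 - 2 * α) * (y - x) ^ (2 * α - 1)) := by
  have hD : 0 < y - x := sub_pos.2 hxy
  have hsubst := lintegral_image_eq_lintegral_abs_deriv_mul measurableSet_Ioo
    (fun s (hs : s ∈ Set.Ioo 0 x) => (hasDerivAt_betaSubst (y := y) hx.ne'
      (by linarith [hs.2])).hasDerivWithinAt) (injOn_betaSubst hx hxy)
    fun w => ENNReal.ofReal (w ^ (α - 1) * (1 - w) ^ (1 - 2 * α - 1))
  simp only [← ENNReal.ofReal_mul (abs_nonneg _)] at hsubst
  rw [image_betaSubst hx hxy, lintegral_beta hα (by linarith), setLIntegral_congr_fun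
    measurableSet_Ioo fun s hs => congrArg ENNReal.ofReal (deriv_betaSubst_mul_rpow hs hxy)]
    at hsubst
  simp only [ENNReal.ofReal_mul (Real.rpow_nonneg hD.le (1 - 2 * α))] at hsubst
  rw [lintegral_const_mul' _ _ (by finiteness), setLIntegral_Ioo_mgKernel_mul] at hsubst
  rw [mul_comm, ENNReal.ofReal_mul (by positivity), hsubst, ← mul_assoc,
    ← ENNReal.ofReal_mul (by positivity), ← Real.rpow_add hD]
  simp

theorem lintegral_mgKernel_mul_rpow {v : ℝ} (hα : 0 < α) (hα' : α < 1 / 2) (hv : 0 < v) :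
    ∫⁻ s, ENNReal.ofReal (mgKernel α s v * s ^ (-α)) = ENNReal.ofReal (beta (1 - 2 * α) α) := by
  have himg : (fun w => v * w) '' Set.Ioo 0 1 = Set.Ioo 0 v := by
    simp [Set.image_mul_left_Ioo hv]
  rw [← setLIntegral_Ioo_mgKernel_mul, ← himg,
    lintegral_image_eq_lintegral_abs_deriv_mul (f' := fun _ => v) measurableSet_Ioo
      (fun w _ => by simpa using ((hasDerivAt_id w).const_mul v).hasDerivWithinAt)
      (mul_right_injective₀ hv.ne').injOn,
    ← lintegral_beta (by linarith) hα]
  refine setLIntegral_congr_fun measurableSet_Ioo ?_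
  rintro w ⟨hw, hw1⟩
  have hw' : 0 < 1 - w := by linarith
  simp only
  rw [← ENNReal.ofReal_mul (abs_nonneg _), abs_of_pos hv,
    mgKernel_of_mem ⟨by positivity, by nlinarith⟩, show v - v * w = v * (1 - w) by ring]
  congr 1
  generalize 1 - w = z at *
  rw [← Real.exp_log hw, ← Real.exp_log hv, ← Real.exp_log hw']
  simp only [← Real.exp_mul, ← Real.exp_add]
  congr 1
  ring

theorem lintegral_mgKernel_mul_exp_mul_rpow_le {s r : ℝ} (hα : 0 < α) (hs : 0 < s) (hr : 0 < r) :
    ∫⁻ v, ENNReal.ofReal (mgKernel α s v * Real.exp (-(r * (v - s))) * v ^ (-α)) ≤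
      ENNReal.ofReal (Real.Gamma α / r ^ α * s ^ (-α)) := by
  have := Real.Gamma_pos_of_pos hα
  have hpt (v : ℝ) : ENNReal.ofReal (mgKernel α s v * Real.exp (-(r * (v - s))) * v ^ (-α)) ≤
      ENNReal.ofReal (Real.Gamma α / r ^ α * s ^ (-α)) * gammaPDF α r (v - s) := by
    by_cases hv : s < v
    · have hvs : 0 < v - s := sub_pos.2 hv
      have hv0 : 0 < v := hs.trans hv
      rw [gammaPDF_of_nonneg hvs.le, ← ENNReal.ofReal_mul (by positivity), mgKernel_of_mem ⟨hs, hv⟩,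
        Real.rpow_neg hv0.le]
      refine ENNReal.ofReal_le_ofReal (le_of_eq ?_)
      field_simp
    · simp [mgKernel_of_notMem fun h : s ∈ Set.Ioo 0 v => hv h.2]
  calc _ ≤ ∫⁻ v, ENNReal.ofReal (Real.Gamma α / r ^ α * s ^ (-α)) * gammaPDF α r (v - s) :=
        lintegral_mono hpt
    _ = _ := by
        rw [lintegral_const_mul' _ _ (by finiteness),
          lintegral_sub_right_eq_self (fun v => gammaPDF α r v) s, lintegral_gammaPDF_eq_one hα hr,
          mul_one]

theorem lintegral_mgKernel_mul_exp_mul_rpow_left_le {r u v : ℝ} (hα : 0 < α) (hα' : α < 1 / 2)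
    (hr : 0 < r) (hv : 0 < v) (hvu : v ≤ u) :
    ∫⁻ s, ENNReal.ofReal (mgKernel α s v * Real.exp (-(r * (v - s))) * s ^ (-α)) ≤
      ENNReal.ofReal (beta (1 - 2 * α) α * u ^ α * v ^ (-α)) := by
  have hb : 0 < beta (1 - 2 * α) α := beta_pos (by linarith) hα
  calc ∫⁻ s, ENNReal.ofReal (mgKernel α s v * Real.exp (-(r * (v - s))) * s ^ (-α))
      ≤ ∫⁻ s, ENNReal.ofReal (mgKernel α s v * s ^ (-α)) := by
        refine lintegral_mono fun s => ENNReal.ofReal_le_ofReal ?_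
        by_cases hs : s ∈ Set.Ioo 0 v
        · have hexp : Real.exp (-(r * (v - s))) ≤ 1 := by
            rw [Real.exp_le_one_iff]
            nlinarith [hs.2]
          exact mul_le_mul_of_nonneg_right (mul_le_of_le_one_right (mgKernel_nonneg _ _ _) hexp)
            (Real.rpow_nonneg hs.1.le _)
        · simp [mgKernel_of_notMem hs]
    _ = ENNReal.ofReal (beta (1 - 2 * α) α) := lintegral_mgKernel_mul_rpow hα hα' hv
    _ ≤ ENNReal.ofReal (beta (1 - 2 * α) α * u ^ α * v ^ (-α)) := by
        refine ENNReal.ofReal_le_ofReal ?_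
        rw [mul_assoc, Real.rpow_neg hv.le, ← div_eq_mul_inv]
        refine le_mul_of_one_le_right hb.le ((one_le_div (Real.rpow_pos_of_pos hv _)).2 ?_)
        exact Real.rpow_le_rpow hv.le hvu hα.le

variable {u : ℝ≥0}

theorem ae_lebesgueOn_pos : ∀ᵐ x ∂lebesgueOn u, 0 < x :=
  ae_lebesgueOn_iff.2 (ae_halfLine_pos.mono fun _ hx _ => hx)

theorem exists_isIntegralOperator_mgKernel {r : ℝ} (hα : 0 < α) (hα' : α < 1 / 2) (hr : 0 < r) :
    ∃ T : L2 u →L[ℝ] L2 u,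
      IsIntegralOperator (lebesgueOn u)
        (fun s v => Real.exp (r * s) * mgKernel α s v * (Real.exp (r * v))⁻¹) T ∧
      ‖T‖ ≤ √(Real.Gamma α / r ^ α * (beta (1 - 2 * α) α * (u : ℝ) ^ α)) := by
  have := Real.Gamma_pos_of_pos hα
  have hb : 0 < beta (1 - 2 * α) α := beta_pos (by linarith) hα
  set A : ℝ≥0 := (Real.Gamma α / r ^ α).toNNReal
  set B : ℝ≥0 := (beta (1 - 2 * α) α * (u : ℝ) ^ α).toNNReal
  have henorm (s v x : ℝ) :
      ‖Real.exp (r * s) * mgKernel α s v * (Real.exp (r * v))⁻¹‖ₑ * ENNReal.ofReal x =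
        ENNReal.ofReal (mgKernel α s v * Real.exp (-(r * (v - s))) * x) := by
    have hk := mul_nonneg (mgKernel_nonneg α s v) (Real.exp_nonneg (-(r * (v - s))))
    rw [ENNReal.ofReal_mul hk, ← Real.enorm_of_nonneg hk, ← Real.exp_neg, mul_right_comm,
      ← Real.exp_add, mul_comm (mgKernel α s v)]
    ring_nf
  have hmeas : Measurable (Function.uncurry fun s v =>
      Real.exp (r * s) * mgKernel α s v * (Real.exp (r * v))⁻¹) :=
    (Measurable.mul (by fun_prop) (measurable_mgKernel α)).mul (by fun_prop)
  obtain ⟨T, hT, hnorm⟩ := exists_isIntegralOperator_of_schur (μ := lebesgueOn u) (A := A) (B := B)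
    hmeas (h := fun s => ENNReal.ofReal (s ^ (-α))) (by fun_prop)
    (ae_lebesgueOn_pos.mono fun s hs => by simpa using Real.rpow_pos_of_pos hs _)
    (Eventually.of_forall fun s => ENNReal.ofReal_ne_top)
    (ae_lebesgueOn_pos.mono fun s hs => by
      simp only [henorm]
      refine (setLIntegral_le_lintegral _ _).trans
        ((lintegral_mgKernel_mul_exp_mul_rpow_le hα hs hr).trans_eq ?_)
      rw [ENNReal.ofReal_mul (by positivity), ENNReal.ofReal])
    (by
      filter_upwards [ae_lebesgueOn_pos, ae_restrict_mem measurableSet_Icc] with v hv hvu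
      simp only [henorm]
      refine (setLIntegral_le_lintegral _ _).trans
        ((lintegral_mgKernel_mul_exp_mul_rpow_left_le hα hα' hr hv hvu.2).trans_eq ?_)
      rw [ENNReal.ofReal_mul (by positivity), ENNReal.ofReal])
  refine ⟨T, hT, hnorm.trans_eq ?_⟩
  rw [Real.coe_sqrt, NNReal.coe_mul, Real.coe_toNNReal _ (by positivity),
    Real.coe_toNNReal _ (by positivity)]

theorem exists_equiv_smul_add_integral_mgKernel {a b : ℝ} (hα : 0 < α) (hα' : α < 1 / 2)
    (ha : a ≠ 0) :
    ∃ A : L2 u ≃L[ℝ] L2 u, ∀ f : L2 u,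
      A f =ᵐ[lebesgueOn u] fun s => a * f s + b * ∫ v, mgKernel α s v * f v ∂lebesgueOn u := by
  -- the weight `e^{rs}` leaves the operator unchanged up to conjugation and makes its norm small
  have hlim : Tendsto (fun r : ℝ => ‖a⁻¹ * b‖ *
      √(Real.Gamma α / r ^ α * (beta (1 - 2 * α) α * (u : ℝ) ^ α))) atTop (𝓝 0) := by
    have hΓ : Tendsto (fun r : ℝ => Real.Gamma α / r ^ α) atTop (𝓝 0) :=
      (tendsto_rpow_atTop hα).const_div_atTop _
    simpa using ((hΓ.mul_const (beta (1 - 2 * α) α * (u : ℝ) ^ α)).sqrt).const_mul ‖a⁻¹ * b‖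
  obtain ⟨r, hr_small, hr⟩ := ((hlim.eventually (gt_mem_nhds zero_lt_one)).and
    (eventually_gt_atTop 0)).exists
  obtain ⟨T, hT, hnorm⟩ := exists_isIntegralOperator_mgKernel (u := u) hα hα' hr
  have hIcc := ae_restrict_mem (μ := volume) (measurableSet_Icc (a := 0) (b := (u : ℝ)))
  refine exists_equiv_smul_add_integral (C := (Real.exp (r * u)).toNNReal) (C' := 1) (by fun_prop)
    (hIcc.mono fun x hx => ?_) (hIcc.mono fun x hx => ?_)
    (Eventually.of_forall fun x => Real.exp_ne_zero _) hT ha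
    ((mul_le_mul_of_nonneg_left hnorm (norm_nonneg _)).trans_lt hr_small)
  · rw [← NNReal.coe_le_coe, coe_nnnorm, Real.norm_of_nonneg (Real.exp_nonneg _),
      Real.coe_toNNReal _ (Real.exp_nonneg _), Real.exp_le_exp]
    exact mul_le_mul_of_nonneg_left hx.2 hr.le
  · rw [← Real.exp_neg, ← NNReal.coe_le_coe, coe_nnnorm, Real.norm_of_nonneg (Real.exp_nonneg _),
      NNReal.coe_one, Real.exp_le_one_iff]
    nlinarith [hx.1]

end MolchanGolosovKernel

section DoubleIntegral

theorem lintegral_mul_lintegral_eq {α β : Type*} {mα : MeasurableSpace α} {mβ : MeasurableSpace β}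
    {μ : Measure α} {ν₁ ν₂ : Measure β} [SFinite μ] [SFinite ν₁] [SFinite ν₂] {k : α → β → ℝ≥0∞}
    (hk : Measurable (Function.uncurry k)) :
    ∫⁻ s, (∫⁻ x, k s x ∂ν₁) * ∫⁻ y, k s y ∂ν₂ ∂μ =
      ∫⁻ x, ∫⁻ y, ∫⁻ s, k s x * k s y ∂μ ∂ν₂ ∂ν₁ := by
  have hk_left (s : α) : Measurable (k s) := hk.comp measurable_prodMk_left
  have hk_right (x : β) : Measurable fun s => k s x := hk.comp measurable_prodMk_right
  have hk₁ : Measurable fun p : (α × β) × β => k p.1.1 p.1.2 := hk.comp measurable_fst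
  have hk₂ : Measurable fun p : (α × β) × β => k p.1.1 p.2 :=
    hk.comp ((measurable_fst.comp measurable_fst).prodMk measurable_snd)
  simp only [← lintegral_mul_const _ (hk_left _), ← lintegral_const_mul _ (hk_left _)]
  rw [lintegral_lintegral_swap (hk₁.mul hk₂).lintegral_prod_right'.aemeasurable]
  refine lintegral_congr fun x => lintegral_lintegral_swap ?_
  exact (((hk_right x).comp measurable_fst).mul hk).aemeasurable

theorem lintegral_Ioo_ofReal_eq {f : ℝ → ℝ} {x y : ℝ} (hxy : x ≤ y)
    (hf : IntervalIntegrable f volume x y) (hf0 : ∀ v ∈ Set.Ioo x y, 0 ≤ f v) :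
    ∫⁻ v in Set.Ioo x y, ENNReal.ofReal (f v) = ENNReal.ofReal (∫ v in x..y, f v) := by
  rw [intervalIntegral.integral_of_le hxy, integral_Ioc_eq_integral_Ioo,
    ofReal_integral_eq_lintegral_ofReal]
  · exact ((intervalIntegrable_iff_integrableOn_Ioc_of_le hxy).1 hf).mono_set
      Set.Ioo_subset_Ioc_self
  · filter_upwards [ae_restrict_mem measurableSet_Ioo] with v hv using hf0 v hv

variable {q : ℝ}

theorem intervalIntegrable_sub_rpow (hq : -1 < q) (x a b : ℝ) :
    IntervalIntegrable (fun y => (y - x) ^ q) volume a b := by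
  simpa using (intervalIntegral.intervalIntegrable_rpow' (a := a - x) (b := b - x)
    hq).comp_sub_right x

theorem intervalIntegrable_const_sub_rpow (hq : -1 < q) (x a b : ℝ) :
    IntervalIntegrable (fun y => (x - y) ^ q) volume a b := by
  simpa using (intervalIntegral.intervalIntegrable_rpow' (a := x - a) (b := x - b)
    hq).comp_sub_left x

theorem lintegral_Ioo_abs_sub_rpow (hq : -1 < q) {x r : ℝ} (hx : 0 ≤ x) (hxr : x ≤ r) :
    ∫⁻ y in Set.Ioo 0 r, ENNReal.ofReal (|x - y| ^ q) =
      ENNReal.ofReal ((x ^ (q + 1) + (r - x) ^ (q + 1)) / (q + 1)) := by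
  have hq1 : q + 1 ≠ 0 := by linarith
  have hleft : Set.EqOn (fun y => |x - y| ^ q) (fun y => (x - y) ^ q) (Set.uIcc 0 x) := by
    intro y hy
    rw [Set.uIcc_of_le hx] at hy
    simp only [abs_of_nonneg (sub_nonneg.2 hy.2)]
  have hright : Set.EqOn (fun y => |x - y| ^ q) (fun y => (y - x) ^ q) (Set.uIcc x r) := by
    intro y hy
    rw [Set.uIcc_of_le hxr] at hy
    simp only [abs_sub_comm x, abs_of_nonneg (sub_nonneg.2 hy.1)]
  have hint_left := (intervalIntegrable_const_sub_rpow hq x 0 x).congr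
    fun y hy => (hleft (Set.uIoc_subset_uIcc hy)).symm
  have hint_right := (intervalIntegrable_sub_rpow hq x x r).congr
    fun y hy => (hright (Set.uIoc_subset_uIcc hy)).symm
  rw [lintegral_Ioo_ofReal_eq (hx.trans hxr) (hint_left.trans hint_right) fun y _ => by positivity,
    ← intervalIntegral.integral_add_adjacent_intervals hint_left hint_right,
    intervalIntegral.integral_congr hleft, intervalIntegral.integral_congr hright,
    intervalIntegral.integral_comp_sub_left (fun y => y ^ q) x,
    intervalIntegral.integral_comp_sub_right (fun y => y ^ q) x,
    integral_rpow (Or.inl hq), integral_rpow (Or.inl hq)]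
  simp only [sub_self, sub_zero, Real.zero_rpow hq1, add_div]

theorem lintegral_Ioo_lintegral_Ioo_abs_sub_rpow (hq : -1 < q) {t r : ℝ} (ht : 0 ≤ t)
    (htr : t ≤ r) :
    ∫⁻ x in Set.Ioo 0 t, ∫⁻ y in Set.Ioo 0 r, ENNReal.ofReal (|x - y| ^ q) =
      ENNReal.ofReal ((t ^ (q + 2) + r ^ (q + 2) - (r - t) ^ (q + 2)) / ((q + 1) * (q + 2))) := by
  have hq1 : 0 < q + 1 := by linarith
  have hint := intervalIntegral.intervalIntegrable_rpow' (a := 0) (b := t) (r := q + 1)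
    (by linarith)
  have hint_sub := intervalIntegrable_const_sub_rpow (q := q + 1) (by linarith) r 0 t
  rw [setLIntegral_congr_fun measurableSet_Ioo fun x hx =>
      lintegral_Ioo_abs_sub_rpow hq hx.1.le (hx.2.le.trans htr),
    lintegral_Ioo_ofReal_eq ht ((hint.add hint_sub).div_const _) fun x hx => ?_,
    intervalIntegral.integral_div, intervalIntegral.integral_add hint hint_sub,
    intervalIntegral.integral_comp_sub_left (fun y => y ^ (q + 1)) r,
    integral_rpow (Or.inl (by linarith)), integral_rpow (Or.inl (by linarith)),
    show q + 1 + 1 = q + 2 by ring, Real.zero_rpow (by linarith), sub_zero, sub_zero]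
  · congr 1
    have hq2 : q + 2 ≠ 0 := by linarith
    field_simp
    ring
  · have hx0 : 0 ≤ x := hx.1.le
    have hrx : 0 ≤ r - x := by linarith [hx.2]
    positivity

end DoubleIntegral

section FractionalKernel

variable {α H : ℝ}

theorem mgKernel_eq_zero_of_le {s v : ℝ} (h : v ≤ s) : mgKernel α s v = 0 :=
  mgKernel_of_notMem fun hs => absurd hs.2 h.not_gt

theorem lintegral_halfLine_mgKernel_mul_mgKernel {x y : ℝ} (hα : 0 < α) (hα' : α < 1 / 2)
    (hx : 0 < x) (hy : 0 < y) (hxy : x ≠ y) :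
    ∫⁻ s, ENNReal.ofReal (mgKernel α s x) * ENNReal.ofReal (mgKernel α s y) ∂halfLine =
      ENNReal.ofReal (beta α (1 - 2 * α) * |x - y| ^ (2 * α - 1)) := by
  simp only [← ENNReal.ofReal_mul (mgKernel_nonneg _ _ _)]
  wlog h : x < y generalizing x y
  · simpa only [mul_comm (mgKernel α _ x), abs_sub_comm x] using
      this hy hx hxy.symm (lt_of_le_of_ne (not_lt.1 h) hxy.symm)
  rw [abs_sub_comm, abs_of_pos (sub_pos.2 h), ← lintegral_mgKernel_mul_mgKernel hα hα' hx h]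
  refine setLIntegral_eq_of_support_subset fun s hs => ?_
  by_contra hs0
  simp [mgKernel_of_notMem fun hsx : s ∈ Set.Ioo 0 x => hs0 (Set.mem_Ici.2 hsx.1.le)] at hs

theorem integrableOn_mgKernel (hα : 0 < α) {s : ℝ} (hs : 0 < s) (t : ℝ) :
    IntegrableOn (mgKernel α s) (Set.Ioo 0 t) := by
  suffices hst : IntegrableOn (mgKernel α s) (Set.Ioo s t) by
    refine hst.of_forall_sdiff_eq_zero measurableSet_Ioo fun v hv => ?_
    exact mgKernel_eq_zero_of_le (not_lt.1 fun hsv => hv.2 ⟨hsv, hv.1.2⟩)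
  rcases le_total s t with hst | hts
  · have hcont : ContinuousOn (fun v : ℝ => s ^ (-α) * v ^ α) (Set.uIcc s t) :=
      (continuous_const.mul (Real.continuous_rpow_const hα.le)).continuousOn
    have hint := (intervalIntegrable_sub_rpow (q := α - 1) (by linarith) s s t).continuousOn_mul
      hcont
    refine (((intervalIntegrable_iff_integrableOn_Ioc_of_le hst).1 hint).mono_set
      Set.Ioo_subset_Ioc_self).congr_fun (fun v hv => ?_) measurableSet_Ioo
    exact (mgKernel_of_mem ⟨hs, hv.1⟩).symm
  · rw [Set.Ioo_eq_empty hts.not_gt]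
    exact integrableOn_empty

theorem setIntegral_Ioo_mgKernel {s : ℝ} (hs : 0 < s) (t : ℝ) :
    ∫ v in Set.Ioo 0 t, mgKernel α s v = ∫ v in Set.Ioo s t, mgKernel α s v :=
  setIntegral_eq_of_subset_of_forall_sdiff_eq_zero measurableSet_Ioo (Set.Ioo_subset_Ioo_left hs.le)
    fun _ hv => mgKernel_eq_zero_of_le (not_lt.1 fun hsv => hv.2 ⟨hsv, hv.1.2⟩)

theorem c_pos (hH : 1 / 2 < H) (hH1 : H < 1) : 0 < c H := by
  have hΓ₁ := Real.Gamma_pos_of_pos (show 0 < 3 / 2 - H by linarith)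
  have := Real.Gamma_pos_of_pos (show 0 < H + 1 / 2 by linarith)
  have hΓ₃ := Real.Gamma_pos_of_pos (show 0 < 2 - 2 * H by linarith)
  have : 0 < H - 1 / 2 := by linarith
  have : 0 < H := by linarith
  unfold c
  positivity

theorem c_sq_mul_beta (hH : 1 / 2 < H) (hH1 : H < 1) :
    c H ^ 2 * beta (H - 1 / 2) (1 - 2 * (H - 1 / 2)) = H * (2 * H - 1) := by
  have hΓ₁ := Real.Gamma_pos_of_pos (show 0 < 3 / 2 - H by linarith)
  have hΓ₂ := Real.Gamma_pos_of_pos (show 0 < H - 1 / 2 by linarith)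
  have hΓ₃ := Real.Gamma_pos_of_pos (show 0 < 2 - 2 * H by linarith)
  have hα : 0 < H - 1 / 2 := by linarith
  have : 0 < H := by linarith
  have hΓ_add : Real.Gamma (H + 1 / 2) = (H - 1 / 2) * Real.Gamma (H - 1 / 2) := by
    rw [← Real.Gamma_add_one hα.ne', show H - 1 / 2 + 1 = H + 1 / 2 by ring]
  rw [c, beta, hΓ_add, mul_pow, Real.sq_sqrt (by positivity),
    show 1 - 2 * (H - 1 / 2) = 2 - 2 * H by ring,
    show H - 1 / 2 + (2 - 2 * H) = 3 / 2 - H by ring]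
  generalize Real.Gamma (3 / 2 - H) = Γ₁ at *
  generalize Real.Gamma (H - 1 / 2) = Γ₂ at *
  generalize Real.Gamma (2 - 2 * H) = Γ₃ at *
  field_simp

theorem mgKernel_eq_div {s v : ℝ} (hs : 0 < s) (hsv : s < v) :
    mgKernel (H - 1 / 2) s v =
      1 / s ^ (H - 1 / 2) * (v ^ (H - 1 / 2) / (v - s) ^ (3 / 2 - H)) := by
  rw [mgKernel_of_mem ⟨hs, hsv⟩, Real.rpow_neg hs.le, show H - 1 / 2 - 1 = -(3 / 2 - H) by ring,
    Real.rpow_neg (sub_pos.2 hsv).le]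
  ring

theorem KH_of_le {s t : ℝ} (h : t ≤ s) : KH H t s = 0 := if_neg h.not_gt

theorem KH_eq_integral_mgKernel {s : ℝ} (hs : 0 < s) (t : ℝ) :
    KH H t s = c H * ∫ v in Set.Ioo 0 t, mgKernel (H - 1 / 2) s v := by
  rw [setIntegral_Ioo_mgKernel hs]
  rcases lt_or_ge s t with hst | hts
  · rw [KH, if_pos hst, mul_assoc, intervalIntegral.integral_of_le hst.le,
      integral_Ioc_eq_integral_Ioo, ← integral_const_mul,
      setIntegral_congr_fun measurableSet_Ioo fun v hv => (mgKernel_eq_div hs hv.1).symm]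
  · rw [KH_of_le hts, Set.Ioo_eq_empty hts.not_gt, setIntegral_empty, mul_zero]

theorem KH_nonneg (hH : 1 / 2 < H) (hH1 : H < 1) {s : ℝ} (hs : 0 < s) (t : ℝ) : 0 ≤ KH H t s := by
  rw [KH_eq_integral_mgKernel hs]
  exact mul_nonneg (c_pos hH hH1).le (integral_nonneg fun v => mgKernel_nonneg _ _ _)

theorem aestronglyMeasurable_KH (t : ℝ) : AEStronglyMeasurable (KH H t) halfLine := by
  have hmeas : StronglyMeasurable fun s =>
      c H * ∫ v in Set.Ioo 0 t, mgKernel (H - 1 / 2) s v :=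
    (measurable_mgKernel (H - 1 / 2)).stronglyMeasurable.integral_prod_right'.const_mul _
  exact hmeas.aestronglyMeasurable.congr
    (ae_halfLine_pos.mono fun s hs => (KH_eq_integral_mgKernel hs t).symm)

theorem ofReal_KH (hH : 1 / 2 < H) (hH1 : H < 1) {s : ℝ} (hs : 0 < s) (t : ℝ) :
    ENNReal.ofReal (KH H t s) = ENNReal.ofReal (c H) *
      ∫⁻ v in Set.Ioo 0 t, ENNReal.ofReal (mgKernel (H - 1 / 2) s v) := by
  rw [KH_eq_integral_mgKernel hs, ENNReal.ofReal_mul (c_pos hH hH1).le,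
    ofReal_integral_eq_lintegral_ofReal (integrableOn_mgKernel (sub_pos.2 hH) hs t)
      (Eventually.of_forall fun v => mgKernel_nonneg _ _ _)]

theorem RH_comm (t r : ℝ) : RH H t r = RH H r t := by
  rw [RH, RH, abs_sub_comm, add_comm (t ^ (2 * H))]

theorem RH_nonneg (hH : 0 ≤ H) {t r : ℝ} (ht : 0 ≤ t) (hr : 0 ≤ r) : 0 ≤ RH H t r := by
  wlog htr : t ≤ r generalizing t r
  · rw [RH_comm]
    exact this hr ht (le_of_not_ge htr)
  have habs : |t - r| ^ (2 * H) ≤ r ^ (2 * H) := by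
    refine Real.rpow_le_rpow (abs_nonneg _) ?_ (by linarith)
    rw [abs_sub_comm, abs_of_nonneg (sub_nonneg.2 htr)]
    linarith
  have ht_rpow : 0 ≤ t ^ (2 * H) := Real.rpow_nonneg ht _
  unfold RH
  linarith

theorem lintegral_KH_mul_KH (hH : 1 / 2 < H) (hH1 : H < 1) {t r : ℝ} (ht : 0 ≤ t) (hr : 0 ≤ r) :
    ∫⁻ s, ENNReal.ofReal (KH H t s * KH H r s) ∂halfLine = ENNReal.ofReal (RH H t r) := by
  wlog htr : t ≤ r generalizing t r
  · rw [RH_comm, ← this hr ht (le_of_not_ge htr)]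
    simp only [mul_comm]
  have hc := c_pos hH hH1
  have hβ : 0 < beta (H - 1 / 2) (1 - 2 * (H - 1 / 2)) := beta_pos (by linarith) (by linarith)
  let k (s v : ℝ) : ℝ≥0∞ := ENNReal.ofReal (mgKernel (H - 1 / 2) s v)
  have hk : Measurable (Function.uncurry k) := (measurable_mgKernel _).ennreal_ofReal
  calc ∫⁻ s, ENNReal.ofReal (KH H t s * KH H r s) ∂halfLine
      = ∫⁻ s, ENNReal.ofReal (c H ^ 2) *
          ((∫⁻ x in Set.Ioo 0 t, k s x) * ∫⁻ y in Set.Ioo 0 r, k s y) ∂halfLine := by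
        refine lintegral_congr_ae (ae_halfLine_pos.mono fun s hs => ?_)
        dsimp only
        rw [ENNReal.ofReal_mul (KH_nonneg hH hH1 hs t), ofReal_KH hH hH1 hs, ofReal_KH hH hH1 hs,
          sq, ENNReal.ofReal_mul hc.le, mul_mul_mul_comm]
    _ = ENNReal.ofReal (c H ^ 2) * ∫⁻ x in Set.Ioo 0 t, ∫⁻ y in Set.Ioo 0 r,
          ∫⁻ s, k s x * k s y ∂halfLine := by
        rw [lintegral_const_mul' _ _ (by finiteness), lintegral_mul_lintegral_eq hk]
    _ = ENNReal.ofReal (c H ^ 2) * ∫⁻ x in Set.Ioo 0 t, ∫⁻ y in Set.Ioo 0 r,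
          ENNReal.ofReal (beta (H - 1 / 2) (1 - 2 * (H - 1 / 2))) *
            ENNReal.ofReal (|x - y| ^ (2 * H - 2)) := by
        congr 1
        refine setLIntegral_congr_fun measurableSet_Ioo fun x hx => lintegral_congr_ae ?_
        filter_upwards [ae_restrict_mem measurableSet_Ioo, Measure.ae_ne (volume.restrict _) x]
          with y hy hxy
        rw [lintegral_halfLine_mgKernel_mul_mgKernel (by linarith) (by linarith) hx.1 hy.1 hxy.symm,
          ENNReal.ofReal_mul hβ.le, show 2 * (H - 1 / 2) - 1 = 2 * H - 2 by ring]
    _ = ENNReal.ofReal (c H ^ 2 * beta (H - 1 / 2) (1 - 2 * (H - 1 / 2)) *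
          ((t ^ (2 * H) + r ^ (2 * H) - (r - t) ^ (2 * H)) / ((2 * H - 1) * (2 * H)))) := by
        simp only [lintegral_const_mul' _ _ ENNReal.ofReal_ne_top]
        rw [lintegral_Ioo_lintegral_Ioo_abs_sub_rpow (by linarith) ht htr, ← mul_assoc,
          ← ENNReal.ofReal_mul (by positivity), ← ENNReal.ofReal_mul (by positivity),
          sub_add_cancel, show 2 * H - 2 + 1 = 2 * H - 1 by ring]
    _ = ENNReal.ofReal (RH H t r) := by
        have : H ≠ 0 := by linarith
        have hH2 : 2 * H - 1 ≠ 0 := by linarith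
        rw [c_sq_mul_beta hH hH1, RH, abs_sub_comm, abs_of_nonneg (sub_nonneg.2 htr)]
        congr 1
        rw [mul_div_assoc', div_eq_iff (by positivity)]
        ring

theorem integral_KH_mul_KH (hH : 1 / 2 < H) (hH1 : H < 1) {t r : ℝ} (ht : 0 ≤ t) (hr : 0 ≤ r) :
    ∫ s, KH H t s * KH H r s ∂halfLine = RH H t r := by
  rw [integral_eq_lintegral_of_nonneg_ae, lintegral_KH_mul_KH hH hH1 ht hr,
    ENNReal.toReal_ofReal (RH_nonneg (by linarith) ht hr)]
  · exact ae_halfLine_pos.mono fun s hs =>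
      mul_nonneg (KH_nonneg hH hH1 hs t) (KH_nonneg hH hH1 hs r)
  · exact (aestronglyMeasurable_KH t).mul (aestronglyMeasurable_KH r)

theorem memLp_KH (hH : 1 / 2 < H) (hH1 : H < 1) {t : ℝ} (ht : 0 ≤ t) :
    MemLp (KH H t) 2 halfLine := by
  rw [memLp_two_iff_integrable_sq (aestronglyMeasurable_KH t)]
  refine ⟨(aestronglyMeasurable_KH t).pow 2, ?_⟩
  rw [hasFiniteIntegral_iff_ofReal (Eventually.of_forall fun s => sq_nonneg _)]
  simp only [sq, lintegral_KH_mul_KH hH hH1 ht ht, ENNReal.ofReal_lt_top]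

end FractionalKernel

section MixedKernel

variable {H a b : ℝ}

theorem integral_ind_mul {S : Set ℝ} (hS : MeasurableSet S) (hS0 : S ⊆ Set.Ici 0) {t : ℝ}
    (ht : 0 ≤ t) (htS : Set.Icc 0 t ⊆ S) (g : ℝ → ℝ) :
    ∫ v in S, ind t v * g v = ∫ v in (0 : ℝ)..t, g v := by
  rw [← intervalIntegral_indicator_eq hS hS0 g ht]
  refine intervalIntegral.integral_congr fun v hv => Set.indicator_of_mem (htS ?_) g
  rwa [Set.uIcc_of_le ht] at hv

theorem integral_ind_mul_KH {t s : ℝ} (ht : 0 ≤ t) (hs : 0 ≤ s) :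
    ∫ v, ind t v * KH H s v ∂halfLine = ∫ v in (0 : ℝ)..min t s, KH H s v := by
  rw [← integral_ind_mul measurableSet_Ici subset_rfl (le_min ht hs) Set.Icc_subset_Ici_self]
  congr 1 with v
  rcases lt_or_ge v s with hvs | hsv
  · simp [ind, Set.indicator, hvs]
  · rw [KH_of_le hsv, mul_zero, mul_zero]

theorem integral_ind_mul_ind {t s : ℝ} (ht : 0 ≤ t) (hs : 0 ≤ s) :
    ∫ v, ind t v * ind s v ∂halfLine = min t s := by
  lift t to ℝ≥0 using ht
  lift s to ℝ≥0 using hs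
  rw [← inner_eq_integral_mul (coeFn_indLp _) (coeFn_indLp _), inner_indLp_indLp, NNReal.coe_min]

theorem intervalIntegrable_of_memLp_two_halfLine {f : ℝ → ℝ} (hf : MemLp f 2 halfLine) {m : ℝ}
    (hm : 0 ≤ m) : IntervalIntegrable f volume 0 m := by
  rw [intervalIntegrable_iff_integrableOn_Ioc_of_le hm]
  exact (hf.mono_measure (Measure.restrict_mono (fun x hx => hx.1.le) le_rfl)).integrable
    one_le_two

theorem memLp_L (hH : 1 / 2 < H) (hH1 : H < 1) {t : ℝ} (ht : 0 ≤ t) :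
    MemLp (L H a b t) 2 halfLine :=
  ((memLp_ind t).const_mul a).add ((memLp_KH hH hH1 ht).const_mul b)

theorem L_of_le {t s : ℝ} (h : t ≤ s) : L H a b t s = 0 := by
  rw [L, ind_of_le h, KH_of_le h, mul_zero, mul_zero, add_zero]

theorem integral_L_mul_L (hH : 1 / 2 < H) (hH1 : H < 1) {t s : ℝ} (ht : 0 ≤ t) (hs : 0 ≤ s) :
    ∫ v, L H a b t v * L H a b s v ∂halfLine = R H a b t s := by
  have hKt := memLp_KH hH hH1 ht
  have hKs := memLp_KH hH hH1 hs
  have hit : MemLp (ind t) 2 halfLine := memLp_ind t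
  have his : MemLp (ind s) 2 halfLine := memLp_ind s
  have hm : 0 ≤ min t s := le_min ht hs
  have hIK : Integrable (fun v => ind s v * KH H t v) halfLine := his.integrable_mul hKt
  have hIK' : Integrable (fun v => ind t v * KH H s v) halfLine := hit.integrable_mul hKs
  have hII : Integrable (fun v => a ^ 2 * (ind t v * ind s v)) halfLine :=
    (hit.integrable_mul his).const_mul _
  have hcross : Integrable (fun v => a * b * (ind s v * KH H t v + ind t v * KH H s v)) halfLine :=
    (hIK.add hIK').const_mul _
  have hKK : Integrable (fun v => b ^ 2 * (KH H t v * KH H s v)) halfLine :=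
    (hKt.integrable_mul hKs).const_mul _
  have hsum : Integrable (fun v => a ^ 2 * (ind t v * ind s v) +
      a * b * (ind s v * KH H t v + ind t v * KH H s v)) halfLine := hII.add hcross
  calc ∫ v, L H a b t v * L H a b s v ∂halfLine
      = ∫ v, (a ^ 2 * (ind t v * ind s v) +
          a * b * (ind s v * KH H t v + ind t v * KH H s v)) +
          b ^ 2 * (KH H t v * KH H s v) ∂halfLine := by
        congr 1 with v
        rw [L, L]
        ring
    _ = a ^ 2 * ∫ v, ind t v * ind s v ∂halfLine +
          a * b * ((∫ v, ind s v * KH H t v ∂halfLine) + ∫ v, ind t v * KH H s v ∂halfLine) +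
          b ^ 2 * ∫ v, KH H t v * KH H s v ∂halfLine := by
        rw [integral_add hsum hKK, integral_add hII hcross, integral_const_mul,
          integral_const_mul, integral_const_mul, integral_add hIK hIK']
    _ = R H a b t s := by
        rw [R, integral_ind_mul_ind ht hs, integral_KH_mul_KH hH hH1 ht hs,
          integral_ind_mul_KH hs ht, integral_ind_mul_KH ht hs, min_comm s t,
          intervalIntegral.integral_add (intervalIntegrable_of_memLp_two_halfLine hKt hm)
            (intervalIntegrable_of_memLp_two_halfLine hKs hm)]

theorem exists_adjointAssociated_equiv (hH : 1 / 2 < H) (hH1 : H < 1) (ha : a ≠ 0) (u : ℝ≥0) :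
    ∃ Lstar : L2 u ≃L[ℝ] L2 u,
      ∀ A : L2 u →L[ℝ] L2 u, IsAdjointAssociated (L H a b) u A ↔ A = Lstar := by
  obtain ⟨Lstar, hLstar⟩ := exists_equiv_smul_add_integral_mgKernel (u := u) (b := b * c H)
    (sub_pos.2 hH) (by linarith) ha
  have hadj : IsAdjointAssociated (L H a b) u (Lstar : L2 u →L[ℝ] L2 u) := by
    intro t ht htu f hf
    have hint (s : ℝ) : ∫ v, mgKernel (H - 1 / 2) s v * f v ∂lebesgueOn u =
        ∫ v in Set.Ioo 0 t, mgKernel (H - 1 / 2) s v := by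
      rw [← integral_Ioc_eq_integral_Ioo, ← intervalIntegral.integral_of_le ht,
        ← integral_ind_mul measurableSet_Icc Set.Icc_subset_Ici_self ht
          (Set.Icc_subset_Icc_right htu)]
      exact integral_congr_ae (hf.mono fun v hv => by simp only [hv, mul_comm])
    filter_upwards [hLstar f, hf, ae_lebesgueOn_pos] with s hs hfs hs0
    rw [ContinuousLinearEquiv.coe_coe, hs, hint, hfs, L, KH_eq_integral_mgKernel hs0, mul_assoc]
  refine ⟨Lstar, fun A => ⟨fun hA => ?_, fun hA => hA ▸ hadj⟩⟩
  refine ContinuousLinearMap.ext_on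
    (Submodule.dense_iff_topologicalClosure_eq_top.2 (topologicalClosure_span_image_indLp_Icc u)) ?_
  rintro _ ⟨t, ht, rfl⟩
  exact Lp.ext ((hA t t.coe_nonneg (NNReal.coe_le_coe.2 ht) _ (coeFn_indLp _)).trans
    (hadj t t.coe_nonneg (NNReal.coe_le_coe.2 ht) _ (coeFn_indLp _)).symm)

end MixedKernel

section RegularCondLaw

variable {Ω α E E' : Type*} [MeasurableSpace α] [MeasurableSpace E] [MeasurableSpace E']

theorem exists_kernel_eq_map (ν : Measure E) [SFinite ν] {Φ : α → E → E'}
    (hΦ : Measurable (Function.uncurry Φ)) : ∃ κ : Kernel α E', ∀ x, κ x = ν.map (Φ x) := by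
  refine ⟨(Kernel.id ×ₖ Kernel.const α ν).map (Function.uncurry Φ), fun x => ?_⟩
  rw [Kernel.map_apply _ hΦ, Kernel.prod_apply, Kernel.id_apply, Kernel.const_apply,
    Measure.dirac_prod, Measure.map_map hΦ measurable_prodMk_left]
  rfl

section

variable [MeasurableSpace Ω] {P : Measure Ω} [IsFiniteMeasure P] {Y : Ω → α} {Z : Ω → E}

theorem lintegral_of_indepFun (hY : Measurable Y) (hZ : Measurable Z) (hYZ : IndepFun Y Z P)
    {f : α × E → ℝ≥0∞} (hf : Measurable f) :
    ∫⁻ ω, f (Y ω, Z ω) ∂P = ∫⁻ ω, ∫⁻ z, f (Y ω, z) ∂P.map Z ∂P := by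
  rw [← lintegral_map (g := fun ω => (Y ω, Z ω)) hf (hY.prodMk hZ),
    (indepFun_iff_map_prod_eq_prod_map_map hY.aemeasurable hZ.aemeasurable).1 hYZ,
    lintegral_prod _ hf.aemeasurable, lintegral_map hf.lintegral_prod_right' hY]

theorem setLIntegral_kernel_of_indepFun (hY : Measurable Y) (hZ : Measurable Z)
    (hYZ : IndepFun Y Z P) {Φ : α → E → E'} (hΦ : Measurable (Function.uncurry Φ))
    {κ : Kernel α E'} (hκ : ∀ x, κ x = (P.map Z).map (Φ x)) {A : Set α} (hA : MeasurableSet A)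
    {B : Set E'} (hB : MeasurableSet B) :
    ∫⁻ ω in Y ⁻¹' A, κ (Y ω) B ∂P = P ((fun ω => Φ (Y ω) (Z ω)) ⁻¹' B ∩ Y ⁻¹' A) := by
  have hD : MeasurableSet (Function.uncurry Φ ⁻¹' B ∩ Prod.fst ⁻¹' A) :=
    (hΦ hB).inter (measurable_fst hA)
  have hΦx (x : α) : Measurable (Φ x) := hΦ.comp measurable_prodMk_left
  calc ∫⁻ ω in Y ⁻¹' A, κ (Y ω) B ∂P
      = ∫⁻ ω, ∫⁻ z, (Function.uncurry Φ ⁻¹' B ∩ Prod.fst ⁻¹' A).indicator 1 (Y ω, z)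
          ∂P.map Z ∂P := by
        rw [← lintegral_indicator (hY hA)]
        refine lintegral_congr fun ω => ?_
        by_cases hω : Y ω ∈ A
        · rw [Set.indicator_of_mem (show ω ∈ Y ⁻¹' A from hω), hκ, Measure.map_apply (hΦx _) hB,
            ← lintegral_indicator_one (hΦx _ hB)]
          exact lintegral_congr fun z => Set.indicator_eq_indicator (by simp [hω]) rfl
        · rw [Set.indicator_of_notMem (show ω ∉ Y ⁻¹' A from hω)]
          simp [hω]
    _ = ∫⁻ ω, (Function.uncurry Φ ⁻¹' B ∩ Prod.fst ⁻¹' A).indicator 1 (Y ω, Z ω) ∂P :=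
        (lintegral_of_indepFun hY hZ hYZ (measurable_one.indicator hD)).symm
    _ = P ((fun ω => Φ (Y ω) (Z ω)) ⁻¹' B ∩ Y ⁻¹' A) :=
        lintegral_indicator_one ((hY.prodMk hZ) hD)

end

variable {F : MeasurableSpace Ω} [mΩ : MeasurableSpace Ω] {P : Measure Ω}

theorem isRegularCondLaw_of_forall_setLIntegral [IsFiniteMeasure P] (hF : F ≤ mΩ) {Y : Ω → E}
    (hY : Measurable Y) {κ : @Kernel Ω E F _} [@IsMarkovKernel Ω E F _ κ]
    (hκ : ∀ A, MeasurableSet[F] A → ∀ B, MeasurableSet B →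
      ∫⁻ ω in A, κ ω B ∂P = P (Y ⁻¹' B ∩ A)) :
    IsRegularCondLaw F Y κ P := by
  intro B hB
  have hm : Measurable[F] fun ω => κ ω B := Kernel.measurable_coe κ hB
  have hsm : StronglyMeasurable[F] fun ω => (κ ω).real B := hm.ennreal_toReal.stronglyMeasurable
  have hint : Integrable (fun ω => (κ ω).real B) P :=
    .of_bound (hsm.mono hF).aestronglyMeasurable 1 <| .of_forall fun ω => by
      rw [Real.norm_of_nonneg measureReal_nonneg]
      exact measureReal_le_one
  refine ae_eq_condExp_of_forall_setIntegral_eq hF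
    ((integrable_const (1 : ℝ)).indicator (hY hB)) (fun A _ _ => hint.integrableOn)
    (fun A hA _ => ?_) hsm.aestronglyMeasurable
  simp only [measureReal_def]
  rw [integral_toReal (hm.mono hF le_rfl).aemeasurable (.of_forall fun ω => measure_lt_top _ _),
    hκ A hA B hB, integral_indicator_const _ (hY hB), smul_eq_mul, mul_one, measureReal_def,
    Measure.restrict_apply (hY hB)]

theorem isRegularCondLaw_of_indep [IsProbabilityMeasure P] (hF : F ≤ mΩ) {Z : Ω → E}
    (hZ : Measurable Z)
    (hind : Indep F (MeasurableSpace.comap Z inferInstance) P) {Φ : Ω → E → E'}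
    (hΦ : Measurable[F.prod inferInstance] (Function.uncurry Φ)) {κ : @Kernel Ω E' F _}
    (hκ : ∀ ω, κ ω = (P.map Z).map (Φ ω)) :
    IsRegularCondLaw F (fun ω => Φ ω (Z ω)) κ P := by
  have hid : Measurable[mΩ, F] (id : Ω → Ω) := fun s hs => hF s hs
  have hidZ : @IndepFun Ω Ω E mΩ F _ id Z P :=
    (@IndepFun_iff_Indep Ω Ω E mΩ F _ id Z P).2 (by rwa [@MeasurableSpace.comap_id Ω F])
  have hΦZ : Measurable fun ω => Φ ω (Z ω) :=
    hΦ.comp (hid.prodMk hZ)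
  have hΦx (ω : Ω) : Measurable (Φ ω) := hΦ.comp (@measurable_prodMk_left _ _ F _ ω)
  have := Measure.isProbabilityMeasure_map (μ := P) hZ.aemeasurable
  have : @IsMarkovKernel Ω E' F _ κ :=
    ⟨fun ω => hκ ω ▸ Measure.isProbabilityMeasure_map (hΦx ω).aemeasurable⟩
  exact isRegularCondLaw_of_forall_setLIntegral hF hΦZ fun A hA B hB =>
    @setLIntegral_kernel_of_indepFun Ω Ω E E' F _ _ mΩ P _ id Z hid hZ hidZ Φ hΦ κ hκ A hA B hB

end RegularCondLaw

section GaussianCondLaw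

theorem isGaussianProcess_const_add {Ω T : Type*} [MeasurableSpace Ω] {P : Measure Ω}
    {Z : T → Ω → ℝ} (hZ : IsGaussianProcess Z P) (m : T → ℝ) :
    IsGaussianProcess (fun t ω => m t + Z t ω) P := by
  refine ⟨fun J => ⟨?_⟩⟩
  have hJ := (hZ.hasGaussianLaw J).isGaussian_map
  have hmap : P.map (fun ω => J.restrict fun t => m t + Z t ω) =
      (P.map fun ω => J.restrict (Z · ω)).map fun x => J.restrict m + x := by
    rw [AEMeasurable.map_map_of_aemeasurable (by fun_prop) (hZ.hasGaussianLaw J).aemeasurable]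
    rfl
  rw [hmap]
  infer_instance

theorem isGaussianProcess_eval_map {Ω T : Type*} [MeasurableSpace Ω] {P : Measure Ω}
    {Y : T → Ω → ℝ} (hY : IsGaussianProcess Y P) (hm : ∀ t, Measurable (Y t)) :
    IsGaussianProcess (fun t (x : T → ℝ) => x t) (P.map fun ω t => Y t ω) := by
  refine ⟨fun J => ⟨?_⟩⟩
  rw [Measure.map_map (by fun_prop) (by fun_prop)]
  exact (hY.hasGaussianLaw J).isGaussian_map

variable {Ω T : Type*} {F : MeasurableSpace Ω} [mΩ : MeasurableSpace Ω] {P : Measure Ω}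

/-- The residual `X_t - E[X_t | F]` of a process `X` after conditioning on `F`. -/
noncomputable def condResidual (P : Measure Ω) (F : MeasurableSpace Ω)
    (X : T → Ω → ℝ) (t : T) (ω : Ω) : ℝ :=
  X t ω - (P[X t | F]) ω

variable {X : T → Ω → ℝ}

theorem measurable_condResidual (hF : F ≤ mΩ) (hX : ∀ t, Measurable (X t)) :
    Measurable fun ω t => condResidual P F X t ω :=
  measurable_pi_lambda _ fun t => (hX t).sub (stronglyMeasurable_condExp.mono hF).measurable

section

variable [IsFiniteMeasure P]

theorem condExp_of_ae_eq_add_indep (hF : F ≤ mΩ) {X M V : Ω → ℝ} (hX : X =ᵐ[P] M + V)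
    (hM : AEStronglyMeasurable[F] M P) (hMi : Integrable M P) (hV : StronglyMeasurable V)
    (hVi : Integrable V P) (hV0 : P[V] = 0)
    (hind : Indep (MeasurableSpace.comap V inferInstance) F P) : P[X | F] =ᵐ[P] M := by
  have hcondV : P[V | F] =ᵐ[P] fun _ => P[V] :=
    condExp_indep_eq hV.measurable.comap_le hF (comap_measurable V).stronglyMeasurable hind
  filter_upwards [condExp_congr_ae (m := F) hX, condExp_add hMi hVi F,
    condExp_of_aestronglyMeasurable' hF hM hMi, hcondV] with ω hX hadd hM hV
  rw [hX, hadd, Pi.add_apply, hM, hV, hV0, add_zero]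

theorem integral_condResidual (hF : F ≤ mΩ) {t : T} (hX : Integrable (X t) P) :
    P[condResidual P F X t] = 0 := by
  simp only [condResidual]
  rw [integral_sub hX integrable_condExp, integral_condExp hF, sub_self]

theorem condExp_condResidual_mul_condResidual (hF : F ≤ mΩ) (hXm : ∀ t, Measurable (X t))
    (hX : ∀ t, Integrable (X t) P)
    (hind : Indep F (MeasurableSpace.comap (fun ω t => condResidual P F X t ω) inferInstance) P)
    (t s : T) :
    P[fun ω => condResidual P F X t ω * condResidual P F X s ω | F] =ᵐ[P]
      fun _ => cov[condResidual P F X t, condResidual P F X s; P] := by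
  have hprod : Measurable fun z : T → ℝ => z t * z s := by fun_prop
  have h := condExp_indep_eq (μ := P)
    (f := fun ω => condResidual P F X t ω * condResidual P F X s ω)
    (measurable_condResidual hF hXm).comap_le hF
    (hprod.comp (comap_measurable fun ω t => condResidual P F X t ω)).stronglyMeasurable hind.symm
  simpa only [covariance, integral_condResidual hF (hX _), sub_zero] using h

end

theorem exists_isRegularCondLaw_isGaussianProcess (hF : F ≤ mΩ) (hXm : ∀ t, Measurable (X t))
    (hX : ∀ t, Integrable (X t) P)
    (hind : Indep F (MeasurableSpace.comap (fun ω t => condResidual P F X t ω) inferInstance) P)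
    (hG : IsGaussianProcess (condResidual P F X) P) :
    ∃ κ : @Kernel Ω (T → ℝ) F _,
      IsRegularCondLaw F (fun ω t => X t ω) κ P ∧
      (∀ ω, IsGaussianProcess (fun t (x : T → ℝ) => x t) (κ ω)) ∧
      (∀ t ω, ∫ x, x t ∂κ ω = (P[X t | F]) ω) ∧
      ∀ ω t s, cov[fun x => x t, fun x => x s; κ ω] =
        cov[condResidual P F X t, condResidual P F X s; P] := by
  have := hG.isProbabilityMeasure
  set Z := condResidual P F X
  have hZ : Measurable fun ω t => Z t ω := measurable_condResidual hF hXm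
  have hZt (t : T) : Measurable (Z t) := measurable_pi_iff.1 hZ t
  have hZi (t : T) : Integrable (Z t) P := (hX t).sub integrable_condExp
  have hadd : Measurable[F.prod inferInstance]
      (Function.uncurry fun ω (z : T → ℝ) t => (P[X t | F]) ω + z t) :=
    @measurable_pi_lambda _ _ _ (F.prod _) _ _ fun t =>
      (stronglyMeasurable_condExp.measurable.comp (@measurable_fst _ _ F _)).add
        ((measurable_pi_apply t).comp (@measurable_snd _ _ F _))
  obtain ⟨κ, hκ⟩ := @exists_kernel_eq_map _ _ _ F _ _ (P.map fun ω t => Z t ω) _ _ hadd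
  have htranslate (ω : Ω) : Measurable fun ω' t => (P[X t | F]) ω + Z t ω' := by fun_prop
  have hκ' (ω : Ω) : κ ω = P.map fun ω' t => (P[X t | F]) ω + Z t ω' := by
    rw [hκ, Measure.map_map (by fun_prop) hZ]
    rfl
  refine ⟨κ, ?_, fun ω => ?_, fun t ω => ?_, fun ω t s => ?_⟩
  · simpa only [Z, condResidual, add_sub_cancel] using isRegularCondLaw_of_indep hF hZ hind hadd hκ
  · rw [hκ']
    exact isGaussianProcess_eval_map (isGaussianProcess_const_add hG _) fun t => by fun_prop
  · rw [hκ', integral_map (htranslate ω).aemeasurable (measurable_pi_apply t).aestronglyMeasurable,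
      integral_add (integrable_const _) (hZi t), integral_condResidual hF (hX t)]
    simp
  · rw [hκ', covariance_map (measurable_pi_apply t).aestronglyMeasurable
      (measurable_pi_apply s).aestronglyMeasurable (htranslate ω).aemeasurable]
    exact (covariance_const_add_left (hZi t) _).trans (covariance_const_add_right (hZi s) _)

end GaussianCondLaw

section VolterraProcess

/-- The part `f 1_{[u,∞)}` of a square-integrable function `f` on the half-line, as an element of
`L²(ℝ₊)`. -/
noncomputable def futurePart {f : ℝ → ℝ} (hf : MemLp f 2 halfLine) (u : ℝ) : Lp ℝ 2 halfLine :=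
  (hf.indicator (measurableSet_Ici (a := u))).toLp

theorem coeFn_futurePart {f : ℝ → ℝ} (hf : MemLp f 2 halfLine) (u : ℝ) :
    futurePart hf u =ᵐ[halfLine] (Set.Ici u).indicator f :=
  MemLp.coeFn_toLp _

theorem inner_futurePart_futurePart {f g : ℝ → ℝ} (hf : MemLp f 2 halfLine)
    (hg : MemLp g 2 halfLine) {u : ℝ} (hu : 0 ≤ u) :
    inner ℝ (futurePart hf u) (futurePart hg u) =
      (∫ v, f v * g v ∂halfLine) - ∫ v in 0..u, f v * g v := by
  have hfg : IntegrableOn (fun v => f v * g v) (Set.Ici 0) := hf.integrable_mul hg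
  have hsplit := intervalIntegral.integral_interval_add_Ioi (hfg.mono_set Set.Ioi_subset_Ici_self)
    (hfg.mono_set (Set.Ioi_subset_Ici hu))
  rw [inner_eq_integral_mul (coeFn_futurePart hf u) (coeFn_futurePart hg u)]
  simp only [← Set.indicator_mul]
  rw [integral_indicator measurableSet_Ici, Measure.restrict_restrict measurableSet_Ici,
    Set.inter_eq_left.2 (Set.Ici_subset_Ici.2 hu), integral_Ici_eq_integral_Ioi,
    integral_Ici_eq_integral_Ioi, ← hsplit, add_sub_cancel_left]

theorem inner_futurePart_eq_zero {f g : ℝ → ℝ} (hf : MemLp f 2 halfLine) (hg : MemLp g 2 halfLine)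
    {u : ℝ} (hg0 : ∀ v, u ≤ v → g v = 0) : inner ℝ (futurePart hf u) hg.toLp = 0 := by
  rw [inner_eq_integral_mul (coeFn_futurePart hf u) hg.coeFn_toLp]
  refine integral_eq_zero_of_ae (.of_forall fun v => ?_)
  by_cases hv : u ≤ v
  · simp [hg0 v hv]
  · simp [hv]

theorem toLp_eq_add_extendZero_add_futurePart {f g : ℝ → ℝ} (hf : MemLp f 2 halfLine)
    (hg : MemLp g 2 halfLine) {u : ℝ≥0} (hg0 : ∀ v, (u : ℝ) ≤ v → g v = 0) {h : L2 u}
    (hh : h =ᵐ[lebesgueOn u] fun v => f v - g v) :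
    hf.toLp = hg.toLp + extendZero u h + futurePart hf u := by
  refine Lp.ext ?_
  filter_upwards [ae_lebesgueOn_iff.1 hh, coeFn_extendZero h, hf.coeFn_toLp, hg.coeFn_toLp,
    coeFn_futurePart hf u, Lp.coeFn_add (hg.toLp + extendZero u h) (futurePart hf u),
    Lp.coeFn_add hg.toLp (extendZero u h), ae_halfLine_pos,
    Measure.ae_ne (volume.restrict _) (u : ℝ)]
    with v hv hext hf hg hfut hadd hadd' hpos hne
  rw [hadd, Pi.add_apply, hadd', Pi.add_apply, hext, hf, hg, hfut]
  rcases lt_or_gt_of_ne hne with hvu | hvu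
  · have hmem : v ∈ Set.Icc (0 : ℝ) u := ⟨hpos.le, hvu.le⟩
    rw [Set.indicator_of_mem hmem, Set.indicator_of_notMem (s := Set.Ici (u : ℝ)) hvu.not_ge,
      hv hmem]
    ring
  · rw [Set.indicator_of_notMem fun hmem => hvu.not_ge hmem.2,
      Set.indicator_of_mem (s := Set.Ici (u : ℝ)) hvu.le, hg0 v hvu.le]
    ring

variable {Ω : Type*} [mΩ : MeasurableSpace Ω] {P : Measure Ω}

/-- `X` is the Gaussian Volterra process with square-integrable kernel `K` driven by the isonormal
process `I` over `L²(ℝ₊)`: `X_t = ∫_0^t K(t,s) dW_s`, where `W_t = I(1_t)` and the integral is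
written `I(K(t,·))`. -/
structure IsVolterraProcess (K : ℝ → ℝ → ℝ) (X : ℝ≥0 → Ω → ℝ) (P : Measure Ω)
    (I : Lp ℝ 2 halfLine →ₗᵢ[ℝ] Lp ℝ 2 P) : Prop where
  isIsonormal : IsIsonormal I
  memLp (t : ℝ≥0) : MemLp (K t) 2 halfLine
  eq_zero_of_le {t : ℝ≥0} {s : ℝ} : t ≤ s → K t s = 0
  ae_eq (t : ℝ≥0) : X t =ᵐ[P] I (memLp t).toLp

/-- The composition of an isometry `I` of `L²(ℝ₊)`, extension by zero and an operator `A` on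
`L²([0,u])`. If `I` drives a Volterra process with kernel `K` and `A` is the operator `K^*`, this is
the Wiener integral against that process on `[0,u]`. -/
noncomputable def wienerOperator (I : Lp ℝ 2 halfLine →ₗᵢ[ℝ] Lp ℝ 2 P) {u : ℝ≥0}
    (A : L2 u →L[ℝ] L2 u) : L2 u →L[ℝ] Lp ℝ 2 P :=
  I.toContinuousLinearMap ∘L extendZero u ∘L A

theorem wienerOperator_apply (I : Lp ℝ 2 halfLine →ₗᵢ[ℝ] Lp ℝ 2 P) {u : ℝ≥0}
    (A : L2 u →L[ℝ] L2 u) (f : L2 u) : wienerOperator I A f = I (extendZero u (A f)) :=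
  rfl

namespace IsVolterraProcess

variable {K : ℝ → ℝ → ℝ} {X : ℝ≥0 → Ω → ℝ} {I : Lp ℝ 2 halfLine →ₗᵢ[ℝ] Lp ℝ 2 P}
  (hX : IsVolterraProcess K X P I) {u : ℝ≥0}

include hX

theorem memLp_two (t : ℝ≥0) : MemLp (X t) 2 P :=
  (Lp.memLp _).ae_eq (hX.ae_eq t).symm

theorem integrable (t : ℝ≥0) : Integrable (X t) P :=
  have := hX.isIsonormal.isProbabilityMeasure
  (hX.memLp_two t).integrable one_le_two

theorem isWienerOperator {A : L2 u →L[ℝ] L2 u} (hA : IsAdjointAssociated K u A) :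
    IsWienerOperator X P u (wienerOperator I A) := by
  intro t ht
  have htu : (t : ℝ) ≤ u := NNReal.coe_le_coe.2 ht
  have hext : extendZero u (A (indLp (Set.Icc 0 u) t)) = (hX.memLp t).toLp :=
    extendZero_eq_toLp _ (fun s hs => hX.eq_zero_of_le (htu.trans hs))
      (hA t t.coe_nonneg htu _ (coeFn_indLp _))
  rw [wienerOperator_apply, hext]
  exact (hX.ae_eq t).symm

theorem exists_apply_ae_eq_sub (Lstar : L2 u ≃L[ℝ] L2 u) (t : ℝ≥0) :
    ∃ ψ : L2 u, Lstar ψ =ᵐ[lebesgueOn u] fun s => K t s - K u s := by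
  have hmem (r : ℝ≥0) : MemLp (K r) 2 (lebesgueOn u) :=
    (hX.memLp r).mono_measure (Measure.restrict_mono Set.Icc_subset_Ici_self le_rfl)
  refine ⟨Lstar.symm ((hmem t).sub (hmem u)).toLp, ?_⟩
  rw [ContinuousLinearEquiv.apply_symm_apply]
  exact MemLp.coeFn_toLp _

theorem ae_eq_add_futurePart {A : L2 u →L[ℝ] L2 u} {t : ℝ≥0} {ψ : L2 u}
    (hψ : A ψ =ᵐ[lebesgueOn u] fun s => K t s - K u s) :
    X t =ᵐ[P] X u + wienerOperator I A ψ + I (futurePart (hX.memLp t) u) := by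
  have hdec := congrArg I (toLp_eq_add_extendZero_add_futurePart (hX.memLp t) (hX.memLp u)
    (fun v hv => hX.eq_zero_of_le hv) hψ)
  rw [map_add, map_add] at hdec
  filter_upwards [hX.ae_eq t, hX.ae_eq u,
    Lp.coeFn_add (I (hX.memLp u).toLp + I (extendZero u (A ψ))) (I (futurePart (hX.memLp t) u)),
    Lp.coeFn_add (I (hX.memLp u).toLp) (I (extendZero u (A ψ)))] with ω ht hu hadd hadd'
  rw [ht, hdec, hadd, Pi.add_apply, hadd', Pi.add_apply, ← hu, Pi.add_apply, Pi.add_apply,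
    wienerOperator_apply]

theorem indep_futurePart {T : Type*} {Z : T → Ω → ℝ} {τ : T → ℝ≥0}
    (hZ : ∀ t, Z t =ᵐ[P] I (futurePart (hX.memLp (τ t)) u)) :
    Indep (sigmaUpTo X u) (MeasurableSpace.comap (fun ω t => Z t ω) inferInstance) P := by
  rw [sigmaUpTo_eq_comap, ← IndepFun_iff_Indep]
  refine hX.isIsonormal.indepFun_of_inner_eq_zero (fun s => hX.ae_eq s) hZ fun s t => ?_
  rw [real_inner_comm]
  exact inner_futurePart_eq_zero _ _ fun v hv =>
    hX.eq_zero_of_le ((NNReal.coe_le_coe.2 s.2).trans hv)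

theorem condExp_ae_eq (hXm : ∀ t, Measurable (X t)) {A : L2 u →L[ℝ] L2 u}
    (hA : IsAdjointAssociated K u A) {t : ℝ≥0} {ψ : L2 u}
    (hψ : A ψ =ᵐ[lebesgueOn u] fun s => K t s - K u s) :
    P[X t | sigmaUpTo X u] =ᵐ[P] X u + wienerOperator I A ψ := by
  have := hX.isIsonormal.isProbabilityMeasure
  have hint (Y : Lp ℝ 2 P) : Integrable Y P := (Lp.memLp Y).integrable one_le_two
  set V : Ω → ℝ := ⇑(I (futurePart (hX.memLp t) u))
  have hV : Indep (MeasurableSpace.comap V inferInstance) (sigmaUpTo X u) P :=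
    (indep_of_indep_of_le_right (hX.indep_futurePart (Z := fun _ : Unit => V) fun _ => ae_eq_rfl)
      ((measurable_pi_apply ()).comp (comap_measurable fun ω (_ : Unit) => V ω)).comap_le).symm
  exact condExp_of_ae_eq_add_indep (sigmaUpTo_le hXm u) (hX.ae_eq_add_futurePart hψ)
    (.add (measurable_sigmaUpTo X le_rfl).stronglyMeasurable.aestronglyMeasurable
      ((hX.isWienerOperator hA).aestronglyMeasurable hXm ψ))
    ((hX.integrable u).add (hint _)) (Lp.stronglyMeasurable _) (hint _)
    (hX.isIsonormal.integral_eq_zero _) hV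

theorem condResidual_ae_eq (hXm : ∀ t, Measurable (X t)) {A : L2 u →L[ℝ] L2 u}
    (hA : IsAdjointAssociated K u A) {t : ℝ≥0} {ψ : L2 u}
    (hψ : A ψ =ᵐ[lebesgueOn u] fun s => K t s - K u s) :
    condResidual P (sigmaUpTo X u) X t =ᵐ[P] I (futurePart (hX.memLp t) u) := by
  filter_upwards [hX.condExp_ae_eq hXm hA hψ, hX.ae_eq_add_futurePart hψ] with ω hcond hdec
  rw [condResidual, hcond, hdec, Pi.add_apply, add_sub_cancel_left]

end IsVolterraProcess

theorem isVolterraProcess_ind {W : ℝ≥0 → Ω → ℝ} {I : Lp ℝ 2 halfLine →ₗᵢ[ℝ] Lp ℝ 2 P}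
    (hI : IsIsonormal I) (hIW : ∀ t : ℝ≥0, I (indLp (Set.Ici 0) t) =ᵐ[P] W t) :
    IsVolterraProcess ind W P I :=
  ⟨hI, fun t => memLp_ind t, fun h => ind_of_le h, fun t => (hIW t).symm⟩

theorem IsVolterraProcess.ae_eq_toLp_of_isWienerIntegral {W : ℝ≥0 → Ω → ℝ}
    {I : Lp ℝ 2 halfLine →ₗᵢ[ℝ] Lp ℝ 2 P} (hW : IsVolterraProcess ind W P I) {u : ℝ≥0}
    {f : ℝ → ℝ} {Y : Ω → ℝ}
    (hf : MemLp f 2 halfLine) (hf0 : ∀ s, (u : ℝ) ≤ s → f s = 0)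
    (hY : IsWienerIntegral W P u f Y) : Y =ᵐ[P] I hf.toLp := by
  have hid : IsAdjointAssociated ind u (.id ℝ (L2 u)) := fun _ _ _ _ h => h
  have hYI := (hW.isWienerOperator hid).ae_eq_of_isWienerIntegral hY hY.1.coeFn_toLp
  rwa [wienerOperator_apply, ContinuousLinearMap.id_apply,
    extendZero_eq_toLp hf hf0 hY.1.coeFn_toLp] at hYI

theorem exists_isVolterraProcess_of_isCcmfBm {H a b : ℝ} {X : ℝ≥0 → Ω → ℝ} (hH : 1 / 2 < H)
    (hH1 : H < 1) (hX : IsCcmfBm H a b X P) : ∃ I, IsVolterraProcess (L H a b) X P I := by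
  obtain ⟨W, BH, hW, hBH, hX⟩ := hX
  obtain ⟨I, hI, hIW⟩ := exists_wienerIsometry hW
  have hK (t : ℝ≥0) : MemLp (KH H t) 2 halfLine := memLp_KH hH hH1 t.coe_nonneg
  have hBHI (t : ℝ≥0) : BH t =ᵐ[P] I (hK t).toLp :=
    (isVolterraProcess_ind hI hIW).ae_eq_toLp_of_isWienerIntegral (hK t)
      (fun _ h => KH_of_le h) (hBH t)
  refine ⟨I, hI, fun t => memLp_L hH hH1 t.coe_nonneg, fun h => L_of_le h, fun t => ?_⟩
  have hL : (memLp_L (a := a) (b := b) hH hH1 t.coe_nonneg).toLp =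
      a • indLp (Set.Ici 0) t + b • (hK t).toLp := by
    rw [indLp, ← MemLp.toLp_const_smul, ← MemLp.toLp_const_smul, ← MemLp.toLp_add]
    rfl
  rw [hL, map_add, map_smul, map_smul]
  filter_upwards [hX t, hIW t, hBHI t,
    Lp.coeFn_add (a • I (indLp (Set.Ici 0) t)) (b • I (hK t).toLp),
    Lp.coeFn_smul a (I (indLp (Set.Ici 0) t)), Lp.coeFn_smul b (I (hK t).toLp)]
    with ω hXω hWω hBω hadd hsmul hsmul'
  rw [hXω, hadd, Pi.add_apply, hsmul, hsmul', Pi.smul_apply, Pi.smul_apply, hWω, ← hBω,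
    smul_eq_mul, smul_eq_mul]

theorem inner_futurePart_L {H a b : ℝ} (hH : 1 / 2 < H) (hH1 : H < 1) {t s : ℝ} (ht : 0 ≤ t)
    (hs : 0 ≤ s) (u : ℝ≥0) :
    inner ℝ (futurePart (memLp_L (a := a) (b := b) hH hH1 ht) u)
      (futurePart (memLp_L (a := a) (b := b) hH hH1 hs) u) = condR H a b u t s := by
  rw [inner_futurePart_futurePart _ _ u.coe_nonneg, integral_L_mul_L hH hH1 ht hs, condR]

end VolterraProcess

end CcmfBm

theorem mainTheorem7 {Ω : Type*} [mΩ : MeasurableSpace Ω] (P : Measure Ω) [IsProbabilityMeasure P]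
    (H a b : ℝ) (hH : 1 / 2 < H) (hH1 : H < 1) (hab : a * b ≠ 0)
    (X : ℝ≥0 → Ω → ℝ) (hXm : ∀ t, Measurable (X t)) (hX : CcmfBm.IsCcmfBm H a b X P) (u : ℝ≥0) :
    -- `L^*` exists as a unique operator on `L²([0,u])`, and it is invertible
    ∃ Lstar : CcmfBm.L2 u ≃L[ℝ] CcmfBm.L2 u,
      (∀ A : CcmfBm.L2 u →L[ℝ] CcmfBm.L2 u,
        CcmfBm.IsAdjointAssociated (CcmfBm.L H a b) u A ↔ A = Lstar) ∧
    -- `Ψ(t,·|u) = (L^*)⁻¹ [L(t,·) - L(u,·)]`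
    ∃ Ψ : {t : ℝ≥0 // u ≤ t} → CcmfBm.L2 u,
      (∀ t, Lstar (Ψ t) =ᵐ[CcmfBm.lebesgueOn u]
        fun s => CcmfBm.L H a b (t : ℝ≥0) s - CcmfBm.L H a b u s) ∧
    -- the conditional mean
      (∀ t, (∃ Y, CcmfBm.IsWienerIntegral X P u (Ψ t) Y) ∧
        ∀ Y, CcmfBm.IsWienerIntegral X P u (Ψ t) Y →
          P[X t | CcmfBm.sigmaUpTo X u] =ᵐ[P] fun ω => X u ω + Y ω) ∧
    -- the conditional covariance
      (∀ t s : {t : ℝ≥0 // u ≤ t},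
        P[fun ω => (X t ω - (P[X t | CcmfBm.sigmaUpTo X u]) ω) *
            (X s ω - (P[X s | CcmfBm.sigmaUpTo X u]) ω) | CcmfBm.sigmaUpTo X u]
          =ᵐ[P] fun _ => CcmfBm.condR H a b u (t : ℝ≥0) (s : ℝ≥0)) ∧
    -- the conditional law of the future process is Gaussian, with this mean and covariance
      ∃ κ : @Kernel Ω ({t : ℝ≥0 // u ≤ t} → ℝ) (CcmfBm.sigmaUpTo X u) _,
        CcmfBm.IsRegularCondLaw (CcmfBm.sigmaUpTo X u)
          (fun ω (t : {t : ℝ≥0 // u ≤ t}) => X t ω) κ P ∧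
        (∀ ω, IsGaussianProcess
          (fun (t : {t : ℝ≥0 // u ≤ t}) (x : {t : ℝ≥0 // u ≤ t} → ℝ) => x t) (κ ω)) ∧
        (∀ t, ∀ᵐ ω ∂P, ∫ x, x t ∂(κ ω) = (P[X t | CcmfBm.sigmaUpTo X u]) ω) ∧
        ∀ ω, ∀ t s : {t : ℝ≥0 // u ≤ t},
          cov[fun x => x t, fun x => x s; κ ω] =
            CcmfBm.condR H a b u (t : ℝ≥0) (s : ℝ≥0) := by
  obtain ⟨Lstar, hLstar⟩ := CcmfBm.exists_adjointAssociated_equiv (b := b) hH hH1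
    (left_ne_zero_of_mul hab) u
  obtain ⟨I, hI⟩ := CcmfBm.exists_isVolterraProcess_of_isCcmfBm hH hH1 hX
  choose Ψ hΨ using fun t : {t : ℝ≥0 // u ≤ t} => hI.exists_apply_ae_eq_sub Lstar t
  have hadj := (hLstar Lstar).2 rfl
  have hJ := hI.isWienerOperator hadj
  have hF := CcmfBm.sigmaUpTo_le hXm u
  have hm (t : {t : ℝ≥0 // u ≤ t}) : Measurable (X t) := hXm t
  have hint (t : {t : ℝ≥0 // u ≤ t}) : Integrable (X t) P := hI.integrable t
  have hres (t : {t : ℝ≥0 // u ≤ t}) := hI.condResidual_ae_eq hXm hadj (hΨ t)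
  have hind := hI.indep_futurePart hres
  have hcov (t s : {t : ℝ≥0 // u ≤ t}) :=
    (hI.isIsonormal.covariance_eq_inner (hres t) (hres s)).trans
      (CcmfBm.inner_futurePart_L hH hH1 t.1.coe_nonneg s.1.coe_nonneg u)
  refine ⟨Lstar, hLstar, Ψ, hΨ, fun t => ⟨⟨_, hJ.isWienerIntegral _⟩, fun Y hY => ?_⟩,
    fun t s => ?_, ?_⟩
  · filter_upwards [hI.condExp_ae_eq hXm hadj (hΨ t), hJ.ae_eq_of_isWienerIntegral hY ae_eq_rfl]
      with ω hcond hYJ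
    rw [hcond, hYJ, Pi.add_apply]
  · rw [← hcov t s]
    exact CcmfBm.condExp_condResidual_mul_condResidual hF hm hint hind t s
  · obtain ⟨κ, hκ, hκG, hκm, hκcov⟩ := CcmfBm.exists_isRegularCondLaw_isGaussianProcess hF hm hint
      hind (hI.isIsonormal.isGaussianProcess_of_ae_eq hres)
    exact ⟨κ, hκ, hκG, fun t => .of_forall (hκm t), fun ω t s => (hκcov ω t s).trans (hcov t s)⟩
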